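/- Let $(M,\mathcal D,g)$ be a sub-Riemannian structure: $M$ is a smooth manifold, $\mathcal D\subseteq TM$ is a smooth bracket-generating sub-bundle of constant rank $k$, and $g$ is a smooth scalar product on $\mathcal D$. Let $\pi:T^*M\to M$ be the cotangent bundle, $\theta$ the Liouville form, $\sigma=d\theta$ the symplectic form (so $\sigma(\partial_{p_i},\partial_{x_j})=\delta_{ij}$), $H(p)=\frac12\sum_{i=1}^k\langle p,X_i\rangle^2$ the Hamiltonian ($X_1,\dots,X_k$ a local orthonormal frame of $\mathcal D$), and $\vec H$ its Hamiltonian field, $\sigma(\cdot,\vec H)=dH$. For a vector field $V$ along an integral curve $\lambda(t)$ of $\vec H$ (an extremal) put $\dot V(t)=\frac{d}{d\varepsilon}\big|_{\varepsilon=0}(e^{-\varepsilon\vec H})_*V(t+\varepsilon)$. For an extremal $\lambda(t)$ with projection $\gamma=\pi\circ\lambda$, let $\mathcal F^i_{\gamma(t)}=\mathrm{span}\{(\mathcal L_{\mathsf T}^jX)|_{\gamma(t)}: X\in\Gamma(\mathcal D),\ 0\le j\le i-1\}$, where $\mathsf T\in\Gamma(\mathcal D)$ extends $\dot\gamma$ near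 $t$, and $\mathcal F^0=0$. The geodesic is ample if for every $t$ some $\mathcal F^m_{\gamma(t)}$ is $T_{\gamma(t)}M$, and equiregular if each $\dim\mathcal F^i_{\gamma(t)}$ is constant in $t$. Its Young diagram $D$ has columns of length $\dim\mathcal F^i-\dim\mathcal F^{i-1}$, $i\ge1$; its rows have lengths $n_a$, and $ai$ denotes the $i$-th box of the row $a$. Let $N\subseteq T^*M$ be the interior of the set of initial covectors of extremals that project, for small times, to ample and equiregular geodesics. A canonical frame along such an extremal is a smooth moving frame $\{E_{ai},F_{ai}\}_{ai\in D}$ along $\lambda(t)$ with $\pi_*E_{ai}=0$; $\sigma(E_{ai},E_{bj})=\sigma(F_{ai},F_{bj})=0$, $\sigma(E_{ai},F_{bj})=\delta_{ab}\delta_{ij}$; and $$\dot E_{ai}=E_{a(i-1)}\ (i\ge2),\quad \dot E_{a1}=-F_{a1},\quad \dot F_{ai}=\sum_{bj}R_{ai,bj}E_{bj}-F_{a(i+1)}\ (i<n_a),\quad \dot F_{an_a}=\sum_{bj}R_{an_a,bj}E_{bj},$$ for a smooth family of normal matrices $R(t)$. Normal means: $R_{ai,bj}=R_{bj,ai}$;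 $R_{ai,b(i+1)}=-R_{bi,a(i+1)}$ if $n_a=n_b$ and $i<n_a$; $R_{ai,bj}=0$ if $n_a=n_b$ and $|i-j|>1$; and $R_{ai,bj}=0$ if $n_a>n_b$ and $(i,j)$ is not among the last $2n_b$ terms of the sequence $(1,1),(1,2),(2,2),(2,3),\dots,(n_b,n_b),(n_b+1,n_b),\dots,(n_a,n_b)$. For $\lambda\in N$, with a canonical frame along the extremal starting at $\lambda$ (its choice is irrelevant), let $\mathcal H_\lambda=\mathrm{span}\{F_{ai}(0)\}$ and let $\mathfrak R_\lambda$ be the bilinear form on $T_{\pi(\lambda)}M$ whose matrix in the basis $X_{ai}=\pi_*F_{ai}(0)$ is $R_{ai,bj}(0)$. Suppose that $\mathcal H$ extends to (or is) a smooth distribution $\mathcal H$ on an open set $U\subseteq T^*M$, complementary to $\mathcal V=\ker\pi_*$, equal to the above on $U\cap N$ (for instance $U=T^*M$): the canonical Ehresmann connection. For a vector field $X$ on $M$ let $\nabla_X$ be its lift with values in $\mathcal H$, and $R^\nabla(X,Y)=[\nabla_X,\nabla_Y]-\nabla_{[X,Y]}$. **Theorem.** Let $W\subseteq M$ be open, $\lambda$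 a smooth section of $T^*M$ over $W$ with values in $U$, $X,Y$ smooth vector fields on $W$, and $\mathsf T=\pi_*\vec H|_\lambda$. Then $$\mathfrak R_\lambda(X,Y)=\sigma_\lambda\big(R^\nabla(\mathsf T,X),\nabla_Y\big)$$ at every $x\in W$ with $\lambda(x)\in N$. Moreover, at every $x\in W$ the right-hand side is the limit of $\mathfrak R_\eta(X,Y)$ as $\eta\to\lambda(x)$ in $N$, so that the formula holds wherever $\lambda(x)\in\overline N$ for the extension of $\mathfrak R$ by continuity. -/

import Mathlib

open scoped Manifold ContDiff Topology

noncomputable section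

namespace SubRiem

/-! ## Vector fields, local flows and Lie derivatives along curves on a general manifold -/

section General

variable {V : Type*} [NormedAddCommGroup V] [NormedSpace ℝ V] {H : Type*} [TopologicalSpace H]
  (I : ModelWithCorners ℝ V H) {P : Type*} [TopologicalSpace P] [ChartedSpace H P]

/-- `φ` is a smooth local flow `(t, q) ↦ e^{tZ}(q)` of the vector field `Z`, defined for times
`|t| < δ` and for initial points in the open neighbourhood `O` of `p`. -/
structure IsLocalFlow (Z : ∀ p : P, TangentSpace I p) (p : P) (φ : ℝ → P → P)
    (δ : ℝ) (O : Set P) : Prop where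
  pos : 0 < δ
  isOpen : IsOpen O
  mem : p ∈ O
  smooth : ContMDiffOn (𝓘(ℝ, ℝ).prod I) I ∞ (fun z : ℝ × P => φ z.1 z.2)
    (Set.Ioo (-δ) δ ×ˢ O)
  init : ∀ q ∈ O, φ 0 q = q
  integral : ∀ q ∈ O, IsMIntegralCurveOn (fun t => φ t q) Z (Set.Ioo (-δ) δ)

/-- `W` is the Lie derivative `d/dε|_{ε=0} (e^{-εZ})_* X(t+ε)` at time `t` of the vector field `X`
along the integral curve `c` of `Z`. All the vectors `(e^{-εZ})_* X(t+ε)` are tangent at the same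
point `c t`; they are compared by means of the chart at `c t`. (The germ of the local flow at `c t`
exists and is unique as soon as `Z` is smooth.) -/
def HasLieDerivAlong (Z : ∀ p : P, TangentSpace I p) (c : ℝ → P)
    (X : ∀ t, TangentSpace I (c t)) (t : ℝ) (W : TangentSpace I (c t)) : Prop :=
  ∃ (φ : ℝ → P → P) (δ : ℝ) (O : Set P), IsLocalFlow I Z (c t) φ δ O ∧
    HasDerivAt
      (fun ε : ℝ => (mfderiv I 𝓘(ℝ, V) (fun q => extChartAt I (c t) (φ (-ε) q)) (c (t + ε))
        (X (t + ε)) : V))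
      (mfderiv I 𝓘(ℝ, V) (extChartAt I (c t)) (c t) W : V) 0

/-- The exterior derivative `dη (v, w)` of the one-form `η` at `p`, computed by pulling `η` back
to the model space with the chart at `p`. -/
def extDerivOneForm (η : ∀ p : P, TangentSpace I p →L[ℝ] ℝ) (p : P) (v w : TangentSpace I p) : ℝ :=
  let η' : V → (V →L[ℝ] ℝ) := fun z =>
    (η ((extChartAt I p).symm z)).comp (mfderiv 𝓘(ℝ, V) I (extChartAt I p).symm z)
  let dχ : TangentSpace I p →L[ℝ] V := mfderiv I 𝓘(ℝ, V) (extChartAt I p) p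
  fderiv ℝ η' (extChartAt I p p) (dχ v) (dχ w) - fderiv ℝ η' (extChartAt I p p) (dχ w) (dχ v)

variable [IsManifold I 1 P]

/-- The vector field `X` is smooth on the set `s`. -/
def SmoothFieldOn (X : ∀ p : P, TangentSpace I p) (s : Set P) : Prop :=
  ContMDiffOn I I.tangent ∞ (fun p => (⟨p, X p⟩ : TangentBundle I P)) s

/-- `X` is a smooth vector field along the curve `c`, for times in `s`. -/
def SmoothFieldAlongOn (c : ℝ → P) (X : ∀ t, TangentSpace I (c t)) (s : Set ℝ) : Prop :=
  ContMDiffOn 𝓘(ℝ, ℝ) I.tangent ∞ (fun t => (⟨c t, X t⟩ : TangentBundle I P)) s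

/-- Iterated Lie brackets of smooth sections of the distribution `D`. -/
inductive IsIteratedBracket (D : ∀ p : P, Submodule ℝ (TangentSpace I p)) :
    (∀ p : P, TangentSpace I p) → Prop
  | base (X : ∀ p : P, TangentSpace I p) (hX : SmoothFieldOn I X Set.univ) (hD : ∀ p, X p ∈ D p) :
      IsIteratedBracket D X
  | bracket (X Y : ∀ p : P, TangentSpace I p) (hX : IsIteratedBracket D X)
      (hY : IsIteratedBracket D Y) : IsIteratedBracket D (VectorField.mlieBracket I X Y)

end General

/-! ## Normal matrices -/

/-- The entry number `p` (starting from `0`) of the sequence of pairs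
`(1,1), (1,2), (2,2), …, (nb,nb), (nb+1,nb), …, (na,nb)`, where both components are lowered by one
(so that columns are numbered starting from `0`). -/
def normalTable (nb p : ℕ) : ℕ × ℕ :=
  (p - min ((p + 1) / 2) (nb - 1), min ((p + 1) / 2) (nb - 1))

/-- The pair `(i, j)` is one of the last `2 * nb` elements of the sequence `normalTable nb`, which
is stopped after `na + nb - 1` elements (for `na > nb`). -/
def InNormalTable (na nb i j : ℕ) : Prop :=
  ∃ p : ℕ, na ≤ p + nb + 1 ∧ p + 1 < na + nb ∧ normalTable nb p = (i, j)

/-- Normal matrices indexed by the boxes of a Young diagram. The box `(a, i)` is the box in row `a`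
and column `i`; rows and columns are numbered starting from `0`, and `Y.rowLen a` is the length
`n_a` of the row `a`. -/
structure IsNormal (Y : YoungDiagram) (R : Y.cells → Y.cells → ℝ) : Prop where
  symm : ∀ b b', R b b' = R b' b
  skew : ∀ (a b i : ℕ) (hai : (a, i) ∈ Y.cells) (hbi : (b, i) ∈ Y.cells)
    (hai' : (a, i + 1) ∈ Y.cells) (hbi' : (b, i + 1) ∈ Y.cells), Y.rowLen a = Y.rowLen b →
      R ⟨(a, i), hai⟩ ⟨(b, i + 1), hbi'⟩ = - R ⟨(b, i), hbi⟩ ⟨(a, i + 1), hai'⟩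
  vanish_eq : ∀ b b' : Y.cells, Y.rowLen b.1.1 = Y.rowLen b'.1.1 →
    (b.1.2 + 1 < b'.1.2 ∨ b'.1.2 + 1 < b.1.2) → R b b' = 0
  vanish_gt : ∀ b b' : Y.cells, Y.rowLen b'.1.1 < Y.rowLen b.1.1 →
    ¬ InNormalTable (Y.rowLen b.1.1) (Y.rowLen b'.1.1) b.1.2 b'.1.2 → R b b' = 0

/-! ## The cotangent bundle and its symplectic structure -/

section Cotangent

variable (E M : Type*) [NormedAddCommGroup E] [NormedSpace ℝ E] [TopologicalSpace M]
  [ChartedSpace E M] [IsManifold 𝓘(ℝ, E) ∞ M]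

/-- The cotangent bundle `T*M`. -/
abbrev CotangentBundle : Type _ :=
  Bundle.TotalSpace (E →L[ℝ] ℝ) (fun x : M => TangentSpace 𝓘(ℝ, E) x →L[ℝ] ℝ)

/-- The model of the manifold `T*M`. -/
abbrev cotangentModel : ModelWithCorners ℝ (E × (E →L[ℝ] ℝ)) (ModelProd E (E →L[ℝ] ℝ)) :=
  𝓘(ℝ, E).prod 𝓘(ℝ, E →L[ℝ] ℝ)

variable {E M}

/-- The differential `π_* : T_p(T*M) → T_{π(p)} M` of the projection `π : T*M → M`. -/
def dproj (p : CotangentBundle E M) :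
    TangentSpace (cotangentModel E) p →L[ℝ] TangentSpace 𝓘(ℝ, E) p.proj :=
  mfderiv (cotangentModel E) 𝓘(ℝ, E) (fun q : CotangentBundle E M => q.proj) p

/-- The vertical subspace `ker π_*`. -/
def vertical (p : CotangentBundle E M) : Submodule ℝ (TangentSpace (cotangentModel E) p) :=
  LinearMap.ker (dproj p).toLinearMap

/-- The Liouville one-form `θ_p = p ∘ π_*`. -/
def liouville (p : CotangentBundle E M) : TangentSpace (cotangentModel E) p →L[ℝ] ℝ :=
  p.snd.comp (dproj p)

/-- The canonical symplectic form `σ = dθ` of `T*M`; in canonical coordinates it is `dp ∧ dx`, so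
that `σ(∂_{p_i}, ∂_{x_j}) = δ_{ij}`. -/
def symplectic (p : CotangentBundle E M) (v w : TangentSpace (cotangentModel E) p) : ℝ :=
  extDerivOneForm (cotangentModel E) liouville p v w

/-- The Hamiltonian vector field of the function `h`, `h⃗`, defined by `σ(w, h⃗) = dh(w)`
for all `w`; in canonical coordinates, `h⃗ = ∂_p h ∂_x - ∂_x h ∂_p`. -/
def hamiltonianField (h : CotangentBundle E M → ℝ) (p : CotangentBundle E M) :
    TangentSpace (cotangentModel E) p :=
  Classical.epsilon fun v => ∀ w : TangentSpace (cotangentModel E) p,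
    symplectic p w v = (mfderiv (cotangentModel E) 𝓘(ℝ, ℝ) h p w : ℝ)

/-! ## Ehresmann connections -/

/-- `hor` is an Ehresmann connection on the set `U ⊆ T*M` (open in the applications): a smooth
distribution on `U` that is a complement of the vertical one. -/
structure IsEhresmannConnectionOn
    (hor : ∀ p : CotangentBundle E M, Submodule ℝ (TangentSpace (cotangentModel E) p))
    (U : Set (CotangentBundle E M)) : Prop where
  isCompl : ∀ p ∈ U, IsCompl (hor p) (vertical p)
  smooth : ∀ p ∈ U, ∃ (O : Set (CotangentBundle E M)) (k : ℕ)
    (Z : Fin k → ∀ q : CotangentBundle E M, TangentSpace (cotangentModel E) q),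
    IsOpen O ∧ p ∈ O ∧ (∀ i, SmoothFieldOn (cotangentModel E) (Z i) O) ∧
    ∀ q ∈ O ∩ U, LinearIndependent ℝ (fun i => Z i q) ∧
      Submodule.span ℝ (Set.range fun i => Z i q) = hor q

/-- The horizontal lift `∇_X`: the vector field on `T*M` with values in `hor` that projects
to `X`. -/
def horizontalLift
    (hor : ∀ p : CotangentBundle E M, Submodule ℝ (TangentSpace (cotangentModel E) p))
    (X : ∀ x : M, TangentSpace 𝓘(ℝ, E) x) (p : CotangentBundle E M) :
    TangentSpace (cotangentModel E) p :=
  Classical.epsilon fun v => v ∈ hor p ∧ dproj p v = X p.proj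

/-- The Ehresmann curvature `R^∇(X, Y) = [∇_X, ∇_Y] - ∇_{[X, Y]}`, a vector field on `T*M`. -/
def ehresmannCurvature
    (hor : ∀ p : CotangentBundle E M, Submodule ℝ (TangentSpace (cotangentModel E) p))
    (X Y : ∀ x : M, TangentSpace 𝓘(ℝ, E) x) (p : CotangentBundle E M) :
    TangentSpace (cotangentModel E) p :=
  VectorField.mlieBracket (cotangentModel E) (horizontalLift hor X) (horizontalLift hor Y) p
    - horizontalLift hor (VectorField.mlieBracket 𝓘(ℝ, E) X Y) p

/-! ## Sub-Riemannian structures -/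

variable (E M)

/-- A sub-Riemannian structure on `M`: a smooth completely non-integrable sub-bundle `D` of `TM`,
of constant rank, with a smooth scalar product `g` on it. Smoothness of `D` and of `g` is expressed
by the existence of smooth local orthonormal frames. -/
structure SubRiemannianStructure where
  rank : ℕ
  D : ∀ x : M, Submodule ℝ (TangentSpace 𝓘(ℝ, E) x)
  g : ∀ x : M, D x →ₗ[ℝ] D x →ₗ[ℝ] ℝ
  g_symm : ∀ x v w, g x v w = g x w v
  g_pos : ∀ x v, v ≠ 0 → 0 < g x v v
  exists_frame : ∀ x : M, ∃ (X : Fin rank → ∀ y : M, D y) (O : Set M), IsOpen O ∧ x ∈ O ∧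
    (∀ i, SmoothFieldOn 𝓘(ℝ, E) (fun y => (X i y : TangentSpace 𝓘(ℝ, E) y)) O) ∧
    ∀ y ∈ O, (∀ i j, g y (X i y) (X j y) = if i = j then 1 else 0) ∧
      Submodule.span ℝ (Set.range fun i => (X i y : TangentSpace 𝓘(ℝ, E) y)) = D y
  bracket_generating : ∀ x : M, Submodule.span ℝ
    {v | ∃ X : ∀ y : M, TangentSpace 𝓘(ℝ, E) y, IsIteratedBracket 𝓘(ℝ, E) D X ∧ X x = v} = ⊤

variable {E M}

namespace SubRiemannianStructure

variable (S : SubRiemannianStructure E M)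

/-- The sub-Riemannian Hamiltonian `H(p) = ½ ∑ᵢ ⟨p, Xᵢ⟩²`, where `X₁, …, X_k` is a local orthonormal
frame around `π(p)` (the value does not depend on the choice of the frame). -/
def hamiltonian (p : CotangentBundle E M) : ℝ :=
  (1 / 2) * ∑ i : Fin S.rank,
    (p.snd ((S.exists_frame p.proj).choose i p.proj : TangentSpace 𝓘(ℝ, E) p.proj)) ^ 2

/-- The sub-Riemannian Hamiltonian vector field. -/
def hamField (p : CotangentBundle E M) : TangentSpace (cotangentModel E) p :=
  hamiltonianField S.hamiltonian p

/-- `c` is an extremal for the times `|t| < ε`. -/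
def IsExtremal (c : ℝ → CotangentBundle E M) (ε : ℝ) : Prop :=
  0 < ε ∧ IsMIntegralCurveOn c S.hamField (Set.Ioo (-ε) ε)

/-- The `i`-th element of the flag of the curve `γ` at time `t`: the span of the values at `γ t` of
the iterated Lie derivatives `L_T^j X`, with `j ≤ i - 1`, of the smooth sections `X` of `D`, where
the smooth section `T` of `D` extends the velocity of `γ` around the time `t`. It is the zero space
for `i = 0`. -/
def flag (γ : ℝ → M) (t : ℝ) (i : ℕ) : Submodule ℝ (TangentSpace 𝓘(ℝ, E) (γ t)) :=
  Submodule.span ℝ {v | ∃ (T X : ∀ x : M, TangentSpace 𝓘(ℝ, E) x) (j : ℕ),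
    SmoothFieldOn 𝓘(ℝ, E) T Set.univ ∧ (∀ x, T x ∈ S.D x) ∧
    (∀ᶠ s in 𝓝 t, T (γ s) = mfderiv 𝓘(ℝ, ℝ) 𝓘(ℝ, E) γ s (1 : ℝ)) ∧
    SmoothFieldOn 𝓘(ℝ, E) X Set.univ ∧ (∀ x, X x ∈ S.D x) ∧
    j < i ∧ v = (fun Y => VectorField.mlieBracket 𝓘(ℝ, E) T Y)^[j] X (γ t)}

/-- The curve `γ` is ample and equiregular for the times `|t| < ε`. -/
structure IsAmpleEquiregular (γ : ℝ → M) (ε : ℝ) : Prop where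
  ample : ∀ t ∈ Set.Ioo (-ε) ε, ∃ m ≥ 1, S.flag γ t m = ⊤
  equiregular : ∀ t ∈ Set.Ioo (-ε) ε, ∀ i,
    Module.finrank ℝ (S.flag γ t i) = Module.finrank ℝ (S.flag γ 0 i)

/-- The set `N` of the covectors that are the initial covector of an extremal whose projection is
ample and equiregular (near the initial time). -/
def ampleEquiregularCovectors : Set (CotangentBundle E M) :=
  {p | ∃ (c : ℝ → CotangentBundle E M) (ε : ℝ), S.IsExtremal c ε ∧ c 0 = p ∧
    S.IsAmpleEquiregular (fun t => (c t).proj) ε}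

/-- A canonical frame `{E_{ai}, F_{ai}}` along the extremal `c`, with `|t| < ε`, whose projection
is ample and equiregular. The box `(a, i)` of the Young diagram `Y` is the box in row `a` and column
`i`, numbered starting from `0`; the length of the column `i` is the increment
`dim F^{i+1} - dim F^i` of the flag. -/
structure CanonicalFrame (c : ℝ → CotangentBundle E M) (ε : ℝ) where
  extremal : S.IsExtremal c ε
  regular : S.IsAmpleEquiregular (fun t => (c t).proj) ε
  Y : YoungDiagram
  colLen_eq : ∀ i, Module.finrank ℝ (S.flag (fun t => (c t).proj) 0 i) + Y.colLen i =
    Module.finrank ℝ (S.flag (fun t => (c t).proj) 0 (i + 1))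
  /-- The vectors `E_{ai}(t)`. -/
  e : Y.cells → ∀ t : ℝ, TangentSpace (cotangentModel E) (c t)
  /-- The vectors `F_{ai}(t)`. -/
  f : Y.cells → ∀ t : ℝ, TangentSpace (cotangentModel E) (c t)
  /-- The curvature matrix `R_{ai,bj}(t)`. -/
  R : ℝ → Y.cells → Y.cells → ℝ
  smooth_e : ∀ b, SmoothFieldAlongOn (cotangentModel E) c (e b) (Set.Ioo (-ε) ε)
  smooth_f : ∀ b, SmoothFieldAlongOn (cotangentModel E) c (f b) (Set.Ioo (-ε) ε)
  smooth_R : ∀ b b', ContDiffOn ℝ ∞ (fun t => R t b b') (Set.Ioo (-ε) ε)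
  vertical_e : ∀ t ∈ Set.Ioo (-ε) ε, ∀ b, e b t ∈ vertical (c t)
  darboux_ee : ∀ t ∈ Set.Ioo (-ε) ε, ∀ b b', symplectic (c t) (e b t) (e b' t) = 0
  darboux_ff : ∀ t ∈ Set.Ioo (-ε) ε, ∀ b b', symplectic (c t) (f b t) (f b' t) = 0
  darboux_ef : ∀ t ∈ Set.Ioo (-ε) ε, ∀ b b',
    symplectic (c t) (e b t) (f b' t) = if b = b' then 1 else 0
  deriv_e_succ : ∀ t ∈ Set.Ioo (-ε) ε, ∀ (a i : ℕ) (h : (a, i) ∈ Y.cells)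
    (h' : (a, i + 1) ∈ Y.cells),
    HasLieDerivAlong (cotangentModel E) S.hamField c (e ⟨(a, i + 1), h'⟩) t (e ⟨(a, i), h⟩ t)
  deriv_e_zero : ∀ t ∈ Set.Ioo (-ε) ε, ∀ (a : ℕ) (h : (a, 0) ∈ Y.cells),
    HasLieDerivAlong (cotangentModel E) S.hamField c (e ⟨(a, 0), h⟩) t (- f ⟨(a, 0), h⟩ t)
  deriv_f : ∀ t ∈ Set.Ioo (-ε) ε, ∀ (a i : ℕ) (h : (a, i) ∈ Y.cells)
    (h' : (a, i + 1) ∈ Y.cells),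
    HasLieDerivAlong (cotangentModel E) S.hamField c (f ⟨(a, i), h⟩) t
      (∑ b, R t ⟨(a, i), h⟩ b • e b t - f ⟨(a, i + 1), h'⟩ t)
  deriv_f_last : ∀ t ∈ Set.Ioo (-ε) ε, ∀ (a i : ℕ) (h : (a, i) ∈ Y.cells),
    (a, i + 1) ∉ Y.cells →
    HasLieDerivAlong (cotangentModel E) S.hamField c (f ⟨(a, i), h⟩) t
      (∑ b, R t ⟨(a, i), h⟩ b • e b t)
  normal : ∀ t ∈ Set.Ioo (-ε) ε, IsNormal Y (R t)

/-- The canonical horizontal space at the covector `p`: the span of the vectors `F_{ai}(0)` of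
a canonical frame along the extremal with initial covector `p`. (The span does not depend on
the choice of the canonical frame.) -/
def canonicalHor (p : CotangentBundle E M) : Submodule ℝ (TangentSpace (cotangentModel E) p) :=
  Submodule.span ℝ {v | ∃ (c : ℝ → CotangentBundle E M) (ε : ℝ) (fr : S.CanonicalFrame c ε)
    (b : fr.Y.cells),
    (⟨c 0, fr.f b 0⟩ : TangentBundle (cotangentModel E) (CotangentBundle E M)) = ⟨p, v⟩}

/-- `r = ∑ R_{ai,bj}(0) α_{ai} β_{bj}`, where `α` and `β` are the components of the tangent vectors
`v` and `w` in the basis `X_{ai} = π_* F_{ai}(0)` given by a canonical frame along the extremal with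
initial covector `p`. -/
def IsCanonicalCurvature (p : CotangentBundle E M) (v w : TangentSpace 𝓘(ℝ, E) p.proj)
    (r : ℝ) : Prop :=
  ∃ (c : ℝ → CotangentBundle E M) (ε : ℝ) (fr : S.CanonicalFrame c ε) (α β : fr.Y.cells → ℝ),
    c 0 = p ∧
    (⟨(c 0).proj, ∑ b, α b • dproj (c 0) (fr.f b 0)⟩ : TangentBundle 𝓘(ℝ, E) M) = ⟨p.proj, v⟩ ∧
    (⟨(c 0).proj, ∑ b, β b • dproj (c 0) (fr.f b 0)⟩ : TangentBundle 𝓘(ℝ, E) M) = ⟨p.proj, w⟩ ∧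
    r = ∑ b, ∑ b', fr.R 0 b b' * α b * β b'

/-- The canonical curvature, as a bilinear form `T_{π(p)} M × T_{π(p)} M → ℝ`, for a covector `p`.
(It does not depend on the choice of the canonical frame.) -/
def canonicalCurvature (p : CotangentBundle E M) (v w : TangentSpace 𝓘(ℝ, E) p.proj) : ℝ :=
  Classical.epsilon (S.IsCanonicalCurvature p v w)

/-- The tangent field `T = π_* H⃗|_lam` of a section `lam` of `T*M`. -/
def tangentField (lam : ∀ x : M, TangentSpace 𝓘(ℝ, E) x →L[ℝ] ℝ) (x : M) :
    TangentSpace 𝓘(ℝ, E) x :=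
  dproj (⟨x, lam x⟩ : CotangentBundle E M) (S.hamField ⟨x, lam x⟩)

end SubRiemannianStructure

end Cotangent

end SubRiem

end

/-! Two properties of the canonical horizontal space carry the proof: it is Lagrangian, and it
contains the Hamiltonian field `H⃗`. The first is the Darboux relation between the `F`'s. The second
is the crux, `stdSymplectic_field_f`. Since `H` is quadratic on the fibres, the vertical Euler field
`u` (which is `(0, ξ)` in canonical coordinates) has Lie derivative `-H⃗` along the extremal, while
that of `H⃗` is zero. Repeated differentiation of `σ(u, E_{ai}) = 0` by means of the structural
equations, with the normality of `R` removing the curvature terms that would interfere, gives `σ(H⃗,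
F_{ai}) = 0`. A vector that is orthogonal to a Lagrangian complement of the vertical space lies in
it, so `H⃗` is horizontal (`lagrangian_of_mem_span`).

Let `V` be a horizontal field. Along an extremal `σ(V, F_b) = 0`, and one differentiation turns the
structural equation of `F_b` into a formula for the curvature matrix: `𝔯(X, Y) = σ([H⃗, ∇_X], ∇_Y)`
(`sum_R_eq`). It remains to exchange `H⃗` for `∇_T`. The two fields agree at `λ(x)`, and their
difference is a horizontal field that vanishes there. The derivative of such a field is horizontal
at that point, so it is annihilated by pairing with `∇_Y` (`stdSymplectic_bracket_eq`). The term
`∇_{[T, X]}` is horizontal as well and does not contribute.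

For the limit, the connection is written near `λ(x)` as the graph of a smooth `Γ`. Symmetry of `Γ`
and horizontality of `H⃗` are closed conditions that hold on the open set `N`; hence they persist on
its closure, and so does the first derivative of the second one. The function `σ([H⃗, ∇_X], ∇_Y)` is
continuous at `λ(x)`, equals the curvature on `N`, and has the required value at `λ(x)` whenever
that point is a limit of `N`. The pointwise formula is then a special case of the limit.

The general existence and uniqueness theory of canonical frames is not needed. Complementarity of
the connection to the vertical space forces a frame to exist at each point of `U ∩ N`, and a
dimension count shows that any single frame spans the horizontal space (`exists_canonicalFrame`,
`CanonicalFrame.span_f_eq`). -/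

noncomputable section

namespace SubRiem

/-! ## Calculus in the model space -/

section Flat

/-- The derivative of the vector field `X` along the curve `c`, transported by the flow map `Ψ`. The
hypothesis `h0` says that `Ψ` is constant to first order along the flow of `Z`. -/
theorem hasDerivAt_fderiv_flow {V V' : Type*} [NormedAddCommGroup V] [NormedSpace ℝ V]
    [NormedAddCommGroup V'] [NormedSpace ℝ V'] {Ψ : ℝ × V → V'} {Z : V → V} {z₀ : V}
    (hΨ : ContDiffAt ℝ 2 Ψ (0, z₀)) (hZ : DifferentiableAt ℝ Z z₀)
    (h0 : ∀ᶠ z in 𝓝 z₀, fderiv ℝ Ψ (0, z) (1, Z z) = 0) {c X : ℝ → V} {X' : V}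
    (hc : HasDerivAt c (Z z₀) 0) (hc0 : c 0 = z₀) (hX : HasDerivAt X X' 0) :
    HasDerivAt (fun s => fderiv ℝ Ψ (s, c s) (0, X s))
      (fderiv ℝ Ψ (0, z₀) (0, X' - fderiv ℝ Z z₀ (X 0))) 0 := by
  have hd : DifferentiableAt ℝ (fderiv ℝ Ψ) (0, z₀) :=
    (hΨ.fderiv_right (m := 1) (by norm_num)).differentiableAt one_ne_zero
  have hsym : IsSymmSndFDerivAt ℝ Ψ (0, z₀) := hΨ.isSymmSndFDerivAt (by simp)
  have hcurve : HasDerivAt (fun s : ℝ => (s, c s)) (1, Z z₀) 0 := (hasDerivAt_id 0).prodMk hc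
  have hd' : HasFDerivAt (fderiv ℝ Ψ) (fderiv ℝ (fderiv ℝ Ψ) (0, z₀)) ((fun s : ℝ => (s, c s)) 0) := by
    simpa [hc0] using hd.hasFDerivAt
  have h1 : HasDerivAt (fun s : ℝ => fderiv ℝ Ψ (s, c s))
      (fderiv ℝ (fderiv ℝ Ψ) (0, z₀) (1, Z z₀)) 0 := hd'.comp_hasDerivAt (0 : ℝ) hcurve
  have h2 := h1.clm_apply ((hasDerivAt_const (0 : ℝ) (0 : ℝ)).prodMk hX)
  refine h2.congr_deriv ?_
  -- differentiate `h0` in the direction `X 0`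
  have hincl : HasFDerivAt (fun z : V => ((0 : ℝ), z)) (ContinuousLinearMap.inr ℝ ℝ V) z₀ :=
    (ContinuousLinearMap.inr ℝ ℝ V).hasFDerivAt
  have h3 : HasFDerivAt (fun z : V => fderiv ℝ Ψ (0, z))
      ((fderiv ℝ (fderiv ℝ Ψ) (0, z₀)).comp (ContinuousLinearMap.inr ℝ ℝ V)) z₀ :=
    hd.hasFDerivAt.comp z₀ hincl
  have h4 := h3.clm_apply ((hasFDerivAt_const (1 : ℝ) z₀).prodMk hZ.hasFDerivAt)
  have h5 : HasFDerivAt (fun z : V => fderiv ℝ Ψ (0, z) (1, Z z)) (0 : V →L[ℝ] V') z₀ :=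
    (hasFDerivAt_const (0 : V') z₀).congr_of_eventuallyEq h0
  have h6 := congrArg (fun L => L (X 0)) (h4.unique h5)
  -- Symmetry of the second derivative identifies the mixed term of the curve derivative with the
  -- one produced by differentiating `h0`; what survives of the latter is the term containing
  -- `fderiv ℝ Z z₀ (X 0)`.
  simp only [hc0, hsym.eq (1, Z z₀) (0, X 0)]
  simp only [add_apply, ContinuousLinearMap.comp_apply,
    ContinuousLinearMap.flip_apply, ContinuousLinearMap.inr_apply,
    ContinuousLinearMap.prod_apply, zero_apply] at h6
  have h7 : ((0 : ℝ), X' - fderiv ℝ Z z₀ (X 0)) = (0, X') - (0, fderiv ℝ Z z₀ (X 0)) := by simp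
  rw [h7, map_sub, ← sub_eq_zero, ← h6]
  abel

/-! ### The standard symplectic form and Hamiltonian fields of sums of squares -/

variable {E : Type*} [NormedAddCommGroup E] [NormedSpace ℝ E]

/-- The standard symplectic form of `E × E*`. -/
def stdSymplectic (v w : E × (E →L[ℝ] ℝ)) : ℝ := v.2 w.1 - w.2 v.1

theorem stdSymplectic_swap (v w : E × (E →L[ℝ] ℝ)) : stdSymplectic w v = - stdSymplectic v w := by
  simp [stdSymplectic]

theorem stdSymplectic_add_left (u v w : E × (E →L[ℝ] ℝ)) :
    stdSymplectic (u + v) w = stdSymplectic u w + stdSymplectic v w := by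
  simp [stdSymplectic]; ring

theorem stdSymplectic_sub_left (u v w : E × (E →L[ℝ] ℝ)) :
    stdSymplectic (u - v) w = stdSymplectic u w - stdSymplectic v w := by
  simp [stdSymplectic]; ring

theorem stdSymplectic_neg_left (v w : E × (E →L[ℝ] ℝ)) :
    stdSymplectic (-v) w = - stdSymplectic v w := by
  simp [stdSymplectic]; ring

theorem stdSymplectic_smul_left (a : ℝ) (v w : E × (E →L[ℝ] ℝ)) :
    stdSymplectic (a • v) w = a * stdSymplectic v w := by
  simp [stdSymplectic]; ring

theorem stdSymplectic_zero_left (w : E × (E →L[ℝ] ℝ)) : stdSymplectic 0 w = 0 := by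
  simp [stdSymplectic]

theorem stdSymplectic_sum_left {ι : Type*} (s : Finset ι) (v : ι → E × (E →L[ℝ] ℝ))
    (w : E × (E →L[ℝ] ℝ)) : stdSymplectic (∑ i ∈ s, v i) w = ∑ i ∈ s, stdSymplectic (v i) w := by
  classical
  induction s using Finset.induction_on with
  | empty => simp [stdSymplectic_zero_left]
  | insert i s hi ih => rw [Finset.sum_insert hi, Finset.sum_insert hi, stdSymplectic_add_left, ih]

theorem stdSymplectic_sum_right {ι : Type*} (s : Finset ι) (v : ι → E × (E →L[ℝ] ℝ))
    (w : E × (E →L[ℝ] ℝ)) : stdSymplectic w (∑ i ∈ s, v i) = ∑ i ∈ s, stdSymplectic w (v i) := by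
  rw [stdSymplectic_swap, stdSymplectic_sum_left, ← Finset.sum_neg_distrib]
  exact Finset.sum_congr rfl fun i _ => (stdSymplectic_swap _ _).symm

theorem stdSymplectic_sub_right (u v w : E × (E →L[ℝ] ℝ)) :
    stdSymplectic w (u - v) = stdSymplectic w u - stdSymplectic w v := by
  simp [stdSymplectic]; ring

theorem stdSymplectic_add_right (u v w : E × (E →L[ℝ] ℝ)) :
    stdSymplectic w (u + v) = stdSymplectic w u + stdSymplectic w v := by
  simp [stdSymplectic]; ring

theorem stdSymplectic_neg_right (v w : E × (E →L[ℝ] ℝ)) :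
    stdSymplectic w (-v) = - stdSymplectic w v := by
  simp [stdSymplectic]; ring

theorem stdSymplectic_smul_right (a : ℝ) (v w : E × (E →L[ℝ] ℝ)) :
    stdSymplectic w (a • v) = a * stdSymplectic w v := by
  simp [stdSymplectic]; ring

/-- Vectors `(u, 0)` detect the covector component. Vectors `(0, g)` detect the base component,
because by Hahn–Banach functionals separate points; no dimension hypothesis is involved. -/
theorem stdSymplectic_nondegenerate {v w : E × (E →L[ℝ] ℝ)}
    (h : ∀ u, stdSymplectic u v = stdSymplectic u w) : v = w := by
  have h2 : v.2 = w.2 := by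
    ext u
    simpa [stdSymplectic] using h (u, 0)
  have h1 : v.1 = w.1 := by
    rw [← sub_eq_zero]
    by_contra hne
    obtain ⟨g, -, hg⟩ := exists_dual_vector ℝ (v.1 - w.1) (norm_ne_zero_iff.2 hne)
    have := h (0, g)
    simp only [stdSymplectic, map_zero, sub_zero] at this
    rw [map_sub, this, sub_self] at hg
    exact hne (norm_eq_zero.1 (by simpa using hg.symm))
  exact Prod.ext h1 h2

theorem hasDerivAt_stdSymplectic {v w : ℝ → E × (E →L[ℝ] ℝ)} {v' w' : E × (E →L[ℝ] ℝ)} {t : ℝ}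
    (hv : HasDerivAt v v' t) (hw : HasDerivAt w w' t) :
    HasDerivAt (fun s => stdSymplectic (v s) (w s))
      (stdSymplectic v' (w t) + stdSymplectic (v t) w') t := by
  have hfst : ∀ {v : ℝ → E × (E →L[ℝ] ℝ)} {v'}, HasDerivAt v v' t →
      HasDerivAt (fun s => (v s).1) v'.1 t := fun h =>
      (ContinuousLinearMap.fst ℝ E (E →L[ℝ] ℝ)).hasFDerivAt.comp_hasDerivAt t h
  have hsnd : ∀ {v : ℝ → E × (E →L[ℝ] ℝ)} {v'}, HasDerivAt v v' t →
      HasDerivAt (fun s => (v s).2) v'.2 t := fun h =>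
      (ContinuousLinearMap.snd ℝ E (E →L[ℝ] ℝ)).hasFDerivAt.comp_hasDerivAt t h
  have h1 := (hsnd hv).clm_apply (hfst hw)
  have h2 := (hsnd hw).clm_apply (hfst hv)
  refine (h1.sub h2).congr_deriv ?_
  simp [stdSymplectic]; ring

/-- A map that preserves the Liouville form preserves the symplectic form. -/
theorem stdSymplectic_map {τ : E × (E →L[ℝ] ℝ) → E × (E →L[ℝ] ℝ)} {z : E × (E →L[ℝ] ℝ)}
    (hτ : ContDiffAt ℝ 2 τ z)
    (h : ∀ᶠ z' in 𝓝 z, ∀ u, (τ z').2 (fderiv ℝ τ z' u).1 = z'.2 u.1) (v w : E × (E →L[ℝ] ℝ)) :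
    stdSymplectic (fderiv ℝ τ z v) (fderiv ℝ τ z w) = stdSymplectic v w := by
  have hd : HasFDerivAt (fderiv ℝ τ) (fderiv ℝ (fderiv ℝ τ) z) z :=
    ((hτ.fderiv_right (m := 1) (by norm_num)).differentiableAt one_ne_zero).hasFDerivAt
  have hd1 : HasFDerivAt τ (fderiv ℝ τ z) z := (hτ.differentiableAt two_ne_zero).hasFDerivAt
  have hsym : IsSymmSndFDerivAt ℝ τ z := hτ.isSymmSndFDerivAt (by simp)
  -- One more differentiation of the Liouville identity. Antisymmetrization in `v` and `w` then
  -- cancels the second derivative of `τ`.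
  have key : ∀ v w, (fderiv ℝ τ z v).2 (fderiv ℝ τ z w).1
      + (τ z).2 (fderiv ℝ (fderiv ℝ τ) z v w).1 = v.2 w.1 := by
    intro v w
    have e1 := (hd1.snd).clm_apply ((hd.clm_apply (hasFDerivAt_const w z)).fst)
    have e2 := (hasFDerivAt_snd (𝕜 := ℝ) (p := z)).clm_apply
      (hasFDerivAt_const (𝕜 := ℝ) (w.1 : E) z)
    have e3 := (e2.congr_of_eventuallyEq (h.mono fun z' hz' => hz' w)).unique e1
    have e4 := congrArg (fun L => L v) e3
    simp at e4
    linarith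
  have k1 := key v w
  have k2 := key w v
  rw [hsym.eq w v] at k2
  simp only [stdSymplectic]
  linarith

/-- The Hamiltonian `½ ∑ ⟨ξ, Xᵢ⟩²` in the model space. -/
def flatHam {k : ℕ} (X : Fin k → E → E) (z : E × (E →L[ℝ] ℝ)) : ℝ :=
  (1 / 2) * ∑ i, (z.2 (X i z.1)) ^ 2

/-- The Hamiltonian field of `½ ∑ ⟨ξ, Xᵢ⟩²` in the model space. -/
def flatHamField {k : ℕ} (X : Fin k → E → E) (z : E × (E →L[ℝ] ℝ)) : E × (E →L[ℝ] ℝ) :=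
  (∑ i, z.2 (X i z.1) • X i z.1, -∑ i, z.2 (X i z.1) • z.2.comp (fderiv ℝ (X i) z.1))

theorem hasFDerivAt_pairing {X : E → E} {z : E × (E →L[ℝ] ℝ)} (hX : DifferentiableAt ℝ X z.1) :
    HasFDerivAt (fun z : E × (E →L[ℝ] ℝ) => z.2 (X z.1))
      (z.2.comp ((fderiv ℝ X z.1).comp (ContinuousLinearMap.fst ℝ E (E →L[ℝ] ℝ)))
        + (ContinuousLinearMap.snd ℝ E (E →L[ℝ] ℝ)).flip (X z.1)) z := by
  have h1 : HasFDerivAt (fun z : E × (E →L[ℝ] ℝ) => X z.1)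
      ((fderiv ℝ X z.1).comp (ContinuousLinearMap.fst ℝ E (E →L[ℝ] ℝ))) z :=
    hX.hasFDerivAt.comp z hasFDerivAt_fst
  exact hasFDerivAt_snd.clm_apply h1

theorem fderiv_flatHam {k : ℕ} {X : Fin k → E → E} {z : E × (E →L[ℝ] ℝ)}
    (hX : ∀ i, DifferentiableAt ℝ (X i) z.1) (w : E × (E →L[ℝ] ℝ)) :
    fderiv ℝ (flatHam X) z w = stdSymplectic w (flatHamField X z) := by
  have h := (HasFDerivAt.fun_sum (u := Finset.univ) fun i _ =>
    (hasFDerivAt_pairing (hX i)).pow 2).const_mul (1 / 2 : ℝ)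
  have h' : HasFDerivAt (flatHam X) _ z := h
  rw [h'.fderiv]
  simp only [stdSymplectic, flatHamField]
  simp [Finset.mul_sum]
  rw [← Finset.sum_add_distrib]
  refine Finset.sum_congr rfl fun i _ => ?_
  ring

theorem contDiffAt_pairing {X : E → E} {z : E × (E →L[ℝ] ℝ)} (hX : ContDiffAt ℝ ∞ X z.1) :
    ContDiffAt ℝ ∞ (fun z : E × (E →L[ℝ] ℝ) => z.2 (X z.1)) z :=
  contDiffAt_snd.clm_apply (hX.comp z contDiffAt_fst)

theorem contDiffAt_flatHam {k : ℕ} {X : Fin k → E → E} {z : E × (E →L[ℝ] ℝ)}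
    (hX : ∀ i, ContDiffAt ℝ ∞ (X i) z.1) : ContDiffAt ℝ ∞ (flatHam X) z :=
  contDiffAt_const.mul (ContDiffAt.sum fun i _ => (contDiffAt_pairing (hX i)).pow 2)

theorem contDiffAt_flatHamField {k : ℕ} {X : Fin k → E → E} {z : E × (E →L[ℝ] ℝ)}
    (hX : ∀ i, ContDiffAt ℝ ∞ (X i) z.1) : ContDiffAt ℝ ∞ (flatHamField X) z := by
  refine ContDiffAt.prodMk ?_ ?_
  · exact ContDiffAt.sum fun i _ =>
      (contDiffAt_pairing (hX i)).smul ((hX i).comp z contDiffAt_fst)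
  · refine ContDiffAt.neg (ContDiffAt.sum fun i _ => (contDiffAt_pairing (hX i)).smul ?_)
    have h1 : ContDiffAt ℝ ∞ (fderiv ℝ (X i)) z.1 := (hX i).fderiv_right (by simp)
    exact contDiffAt_snd.clm_comp (h1.comp z contDiffAt_fst)

/-- The linearization of a Hamiltonian field is an infinitesimal symplectic map. -/
theorem stdSymplectic_fderiv_flatHamField {k : ℕ} {X : Fin k → E → E} {z : E × (E →L[ℝ] ℝ)}
    (hX : ∀ i, ContDiffAt ℝ ∞ (X i) z.1) (v w : E × (E →L[ℝ] ℝ)) :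
    stdSymplectic (fderiv ℝ (flatHamField X) z v) w
      + stdSymplectic v (fderiv ℝ (flatHamField X) z w) = 0 := by
  have hh := contDiffAt_flatHam hX
  have hsym : IsSymmSndFDerivAt ℝ (flatHam X) z := hh.isSymmSndFDerivAt (by simp; norm_cast)
  have hd : HasFDerivAt (fderiv ℝ (flatHam X)) (fderiv ℝ (fderiv ℝ (flatHam X)) z) z :=
    ((hh.fderiv_right (m := 1) (by norm_cast)).differentiableAt one_ne_zero).hasFDerivAt
  have hF : HasFDerivAt (flatHamField X) (fderiv ℝ (flatHamField X) z) z :=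
    ((contDiffAt_flatHamField hX).differentiableAt (by simp)).hasFDerivAt
  have hev : ∀ᶠ z' in 𝓝 z, ∀ w, fderiv ℝ (flatHam X) z' w = stdSymplectic w (flatHamField X z') := by
    have : ∀ i, ∀ᶠ z' : E × (E →L[ℝ] ℝ) in 𝓝 z, DifferentiableAt ℝ (X i) z'.1 := fun i =>
      continuousAt_fst.eventually
        ((((hX i).of_le (m := 1) (by norm_cast)).eventually (by simp)).mono
          fun x hx => hx.differentiableAt (by simp))
    filter_upwards [Filter.eventually_all.2 this] with z' hz' w using fderiv_flatHam hz' w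
  -- The linearized field is the Hessian of the Hamiltonian seen through the symplectic form, so the
  -- claim is the symmetry of the Hessian.
  have key : ∀ v w, fderiv ℝ (fderiv ℝ (flatHam X)) z v w
      = stdSymplectic w (fderiv ℝ (flatHamField X) z v) := by
    intro v w
    have e1 := hd.clm_apply (hasFDerivAt_const w z)
    have e2 := (w.2.hasFDerivAt.comp z hF.fst).sub (hF.snd.clm_apply (hasFDerivAt_const w.1 z))
    have e3 := (e2.congr_of_eventuallyEq (hev.mono fun z' hz' => hz' w)).unique e1
    have e4 := congrArg (fun L => L v) e3
    simp only [ContinuousLinearMap.comp_apply, sub_apply, add_apply,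
      ContinuousLinearMap.flip_apply, zero_apply, map_zero, zero_add,
      ContinuousLinearMap.coe_fst', ContinuousLinearMap.coe_snd'] at e4
    simp only [stdSymplectic]
    linarith
  rw [stdSymplectic_swap, ← key v w, ← key w v, hsym.eq]
  ring

/-- The Hamiltonian field is homogeneous. -/
theorem fderiv_flatHamField_euler {k : ℕ} {X : Fin k → E → E} {z : E × (E →L[ℝ] ℝ)}
    (hX : ∀ i, ContDiffAt ℝ ∞ (X i) z.1) :
    fderiv ℝ (flatHamField X) z (0, z.2)
      = ((flatHamField X z).1, (2 : ℝ) • (flatHamField X z).2) := by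
  -- The base point is written as the value at `s = 1` of the ray `s ↦ (x, s ξ)`, on which the two
  -- components of the field have degree one and two in `s`.
  have hF : HasFDerivAt (flatHamField X) (fderiv ℝ (flatHamField X) z) (z.1, (1 : ℝ) • z.2) := by
    simpa using ((contDiffAt_flatHamField hX).differentiableAt (by simp)).hasFDerivAt
  have hc : HasDerivAt (fun s : ℝ => ((z.1, s • z.2) : E × (E →L[ℝ] ℝ))) (0, (1 : ℝ) • z.2) 1 :=
    (hasDerivAt_const _ _).prodMk ((hasDerivAt_id _).smul_const z.2)
  have h1 := hF.comp_hasDerivAt (1 : ℝ) hc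
  have h2 : (flatHamField X ∘ fun s : ℝ => ((z.1, s • z.2) : E × (E →L[ℝ] ℝ)))
      = fun s => (s • (flatHamField X z).1, (s ^ 2) • (flatHamField X z).2) := by
    funext s
    simp [flatHamField, Finset.smul_sum, smul_smul, pow_two, mul_assoc]
    simp [mul_comm]
  rw [h2] at h1
  have h3 : HasDerivAt (fun s : ℝ => (s • (flatHamField X z).1, (s ^ 2) • (flatHamField X z).2))
      ((1 : ℝ) • (flatHamField X z).1, (((2 : ℕ) : ℝ) * 1 ^ (2 - 1)) • (flatHamField X z).2) 1 :=
    ((hasDerivAt_id (1 : ℝ)).smul_const _).prodMk (HasDerivAt.smul_const (f := (flatHamField X z).2) (hasDerivAt_pow 2 (1 : ℝ)))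
  have h4 := h1.unique h3
  simpa using h4

end Flat

/-! ### Canonical frames in the model space -/

section FlatFrame

variable {E : Type*} [NormedAddCommGroup E] [NormedSpace ℝ E]

/-- A canonical frame along an integral curve `c` of the field `Z` in the model space, for times
in `J`. -/
structure IsFlatFrame (Z : E × (E →L[ℝ] ℝ) → E × (E →L[ℝ] ℝ)) (c : ℝ → E × (E →L[ℝ] ℝ))
    (Y : YoungDiagram) (e f : Y.cells → ℝ → E × (E →L[ℝ] ℝ)) (R : ℝ → Y.cells → Y.cells → ℝ)
    (J : Set ℝ) : Prop where
  integral : ∀ t ∈ J, HasDerivAt c (Z (c t)) t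
  vertical_e : ∀ t ∈ J, ∀ b, (e b t).1 = 0
  darboux_ee : ∀ t ∈ J, ∀ b b', stdSymplectic (e b t) (e b' t) = 0
  darboux_ff : ∀ t ∈ J, ∀ b b', stdSymplectic (f b t) (f b' t) = 0
  darboux_ef : ∀ t ∈ J, ∀ b b', stdSymplectic (e b t) (f b' t) = if b = b' then 1 else 0
  deriv_e_succ : ∀ t ∈ J, ∀ (a i : ℕ) (h : (a, i) ∈ Y.cells) (h' : (a, i + 1) ∈ Y.cells),
    HasDerivAt (e ⟨(a, i + 1), h'⟩)
      (e ⟨(a, i), h⟩ t + fderiv ℝ Z (c t) (e ⟨(a, i + 1), h'⟩ t)) t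
  deriv_e_zero : ∀ t ∈ J, ∀ (a : ℕ) (h : (a, 0) ∈ Y.cells),
    HasDerivAt (e ⟨(a, 0), h⟩)
      (- f ⟨(a, 0), h⟩ t + fderiv ℝ Z (c t) (e ⟨(a, 0), h⟩ t)) t
  deriv_f : ∀ t ∈ J, ∀ (a i : ℕ) (h : (a, i) ∈ Y.cells) (h' : (a, i + 1) ∈ Y.cells),
    HasDerivAt (f ⟨(a, i), h⟩)
      ((∑ b, R t ⟨(a, i), h⟩ b • e b t - f ⟨(a, i + 1), h'⟩ t)
        + fderiv ℝ Z (c t) (f ⟨(a, i), h⟩ t)) t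
  deriv_f_last : ∀ t ∈ J, ∀ (a i : ℕ) (h : (a, i) ∈ Y.cells), (a, i + 1) ∉ Y.cells →
    HasDerivAt (f ⟨(a, i), h⟩)
      (∑ b, R t ⟨(a, i), h⟩ b • e b t + fderiv ℝ Z (c t) (f ⟨(a, i), h⟩ t)) t
  normal : ∀ t ∈ J, IsNormal Y (R t)

/-- The Leibniz rule for the symplectic form and Lie derivatives along a Hamiltonian field. -/
theorem hasDerivAt_stdSymplectic_lie {L : (E × (E →L[ℝ] ℝ)) → E × (E →L[ℝ] ℝ)}
    {v w : ℝ → E × (E →L[ℝ] ℝ)} {v' w' : E × (E →L[ℝ] ℝ)} {t : ℝ}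
    (hL : stdSymplectic (L (v t)) (w t) + stdSymplectic (v t) (L (w t)) = 0)
    (hv : HasDerivAt v (v' + L (v t)) t) (hw : HasDerivAt w (w' + L (w t)) t) :
    HasDerivAt (fun s => stdSymplectic (v s) (w s))
      (stdSymplectic v' (w t) + stdSymplectic (v t) w') t := by
  refine (hasDerivAt_stdSymplectic hv hw).congr_deriv ?_
  rw [stdSymplectic_add_left, stdSymplectic_add_right]
  linarith

namespace IsFlatFrame

variable {Z : E × (E →L[ℝ] ℝ) → E × (E →L[ℝ] ℝ)} {c : ℝ → E × (E →L[ℝ] ℝ)}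
    {Y : YoungDiagram} {e f : Y.cells → ℝ → E × (E →L[ℝ] ℝ)} {R : ℝ → Y.cells → Y.cells → ℝ}
    {J : Set ℝ}

/-- Treats inner and last boxes together: `g` is the next `f` of the row, or zero at its end. In
`sum_R_eq` all that matters about `g` is its orthogonality to horizontal fields. -/
theorem hasDerivAt_f (h : IsFlatFrame Z c Y e f R J) {t : ℝ} (ht : t ∈ J) (b : Y.cells) :
    ∃ g : E × (E →L[ℝ] ℝ), HasDerivAt (f b) ((∑ b', R t b b' • e b' t - g)
        + fderiv ℝ Z (c t) (f b t)) t ∧ (g = 0 ∨ ∃ b', g = f b' t) := by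
  obtain ⟨⟨a, i⟩, hb⟩ := b
  by_cases h' : (a, i + 1) ∈ Y.cells
  · exact ⟨_, h.deriv_f t ht a i hb h', Or.inr ⟨_, rfl⟩⟩
  · exact ⟨0, by simpa using h.deriv_f_last t ht a i hb h', Or.inl rfl⟩

/-- The row `a'` has length one. For `n_b = 1` the sequence in the normality condition is `(1,1),
(2,1), …, (n_a,1)`, of which only the last two pairs are allowed; a box with two more boxes on its
right is not among them. -/
theorem R_eq_zero {R : Y.cells → Y.cells → ℝ} (h : IsNormal Y R) {a a' i : ℕ}
    (hb : (a, i) ∈ Y.cells) (hb' : (a', 0) ∈ Y.cells) (hi : (a, i + 2) ∈ Y.cells)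
    (ha' : (a', 1) ∉ Y.cells) : R ⟨(a, i), hb⟩ ⟨(a', 0), hb'⟩ = 0 := by
  rw [YoungDiagram.mem_cells, YoungDiagram.mem_iff_lt_rowLen] at hi ha' 
  have hb'' := hb'
  rw [YoungDiagram.mem_cells, YoungDiagram.mem_iff_lt_rowLen] at hb''
  have h1 : Y.rowLen a' = 1 := by omega
  apply h.vanish_gt
  · simp only [h1]; omega
  · rintro ⟨p, hp1, hp2, hp3⟩
    simp only [h1, normalTable, Prod.mk.injEq] at hp1 hp3
    omega

/-- The derivative of the Euler field along an integral curve of the Hamiltonian field. -/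
theorem hasDerivAt_euler {k : ℕ} {X : Fin k → E → E} (h : IsFlatFrame (flatHamField X) c Y e f R J)
    (hX : ∀ t ∈ J, ∀ i, ContDiffAt ℝ ∞ (X i) (c t).1) {t : ℝ} (ht : t ∈ J) :
    HasDerivAt (fun s => ((0, (c s).2) : E × (E →L[ℝ] ℝ)))
      (-flatHamField X (c t) + fderiv ℝ (flatHamField X) (c t) (0, (c t).2)) t := by
  have h1 : HasDerivAt (fun s => (c s).2) (flatHamField X (c t)).2 t :=
    (ContinuousLinearMap.snd ℝ E (E →L[ℝ] ℝ)).hasFDerivAt.comp_hasDerivAt t (h.integral t ht)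
  refine ((hasDerivAt_const t (0 : E)).prodMk h1).congr_deriv ?_
  -- By homogeneity the linearization doubles the covector component of the field, which leaves `-Z
  -- + (Z.1, 2 Z.2) = (0, Z.2)`.
  rw [fderiv_flatHamField_euler (hX t ht)]
  ext1
  · simp
  · simp only [Prod.snd_add, Prod.snd_neg]
    rw [two_smul]; abel

/-- The summand `0` is the Lie derivative of the Hamiltonian field along its own flow; the sum has
the shape required by `hasDerivAt_stdSymplectic_lie`. -/
theorem hasDerivAt_field {k : ℕ} {X : Fin k → E → E}
    (h : IsFlatFrame (flatHamField X) c Y e f R J)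
    (hX : ∀ t ∈ J, ∀ i, ContDiffAt ℝ ∞ (X i) (c t).1) {t : ℝ} (ht : t ∈ J) :
    HasDerivAt (fun s => flatHamField X (c s))
      (0 + fderiv ℝ (flatHamField X) (c t) (flatHamField X (c t))) t := by
  rw [zero_add]
  exact ((contDiffAt_flatHamField (hX t ht)).differentiableAt (by simp)).hasFDerivAt.comp_hasDerivAt
    t (h.integral t ht)

theorem _root_.HasDerivAt.eq_zero_of_eqOn {x : ℝ → ℝ} {x' t : ℝ} {J : Set ℝ} (hJ : IsOpen J)
    (ht : t ∈ J) (h : HasDerivAt x x' t) (h0 : ∀ s ∈ J, x s = 0) : x' = 0 :=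
  h.unique ((hasDerivAt_const t (0 : ℝ)).congr_of_eventuallyEq
    (Filter.eventually_of_mem (hJ.mem_nhds ht) h0))

/-- The Hamiltonian field is symplectically orthogonal to the vectors `f` of a canonical frame. -/
theorem stdSymplectic_field_f {k : ℕ} {X : Fin k → E → E}
    (h : IsFlatFrame (flatHamField X) c Y e f R J) (hJ : IsOpen J)
    (hX : ∀ t ∈ J, ∀ i, ContDiffAt ℝ ∞ (X i) (c t).1) {t : ℝ} (ht : t ∈ J) (b : Y.cells) :
    stdSymplectic (flatHamField X (c t)) (f b t) = 0 := by
  set Z := flatHamField X with hZ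
  have hL : ∀ t ∈ J, ∀ v w, stdSymplectic (fderiv ℝ Z (c t) v) w
      + stdSymplectic v (fderiv ℝ Z (c t) w) = 0 := fun t ht v w =>
    stdSymplectic_fderiv_flatHamField (hX t ht) v w
  have hE := fun t ht => h.hasDerivAt_euler hX (t := t) ht
  have hH := fun t ht => h.hasDerivAt_field hX (t := t) ht
  -- `u` is the Euler field. With `x_{ai} = σ(u, f_{ai})` and `y_{ai} = σ(Z, f_{ai})`, the goal is
  -- `y = 0`; it follows from a system of differential relations between the `x` and the `y`.
  set u : ℝ → E × (E →L[ℝ] ℝ) := fun s => ((0, (c s).2) : E × (E →L[ℝ] ℝ)) with hu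
  have hue : ∀ t ∈ J, ∀ b, stdSymplectic (u t) (e b t) = 0 := fun t ht b => by
    simp [stdSymplectic, hu, h.vertical_e t ht b]
  -- the components of the Hamiltonian field along the `f`s
  have he_succ : ∀ t ∈ J, ∀ (a i : ℕ) (h' : (a, i + 1) ∈ Y.cells),
      stdSymplectic (Z (c t)) (e ⟨(a, i + 1), h'⟩ t) = 0 := by
    intro t ht a i h'
    have hb : (a, i) ∈ Y.cells := Y.up_left_mem le_rfl (Nat.le_succ i) h'
    have := (hasDerivAt_stdSymplectic_lie (hL t ht _ _) (hE t ht)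
      (h.deriv_e_succ t ht a i hb h')).eq_zero_of_eqOn hJ ht fun s hs => hue s hs _
    rw [stdSymplectic_neg_left, show stdSymplectic (u t) (e ⟨(a, i), hb⟩ t) = 0 from hue t ht _]
      at this
    linarith
  have he_zero : ∀ t ∈ J, ∀ (a : ℕ) (hb : (a, 0) ∈ Y.cells),
      stdSymplectic (Z (c t)) (e ⟨(a, 0), hb⟩ t) = -stdSymplectic (u t) (f ⟨(a, 0), hb⟩ t) := by
    intro t ht a hb
    have := (hasDerivAt_stdSymplectic_lie (hL t ht _ _) (hE t ht)
      (h.deriv_e_zero t ht a hb)).eq_zero_of_eqOn hJ ht fun s hs => hue s hs _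
    rw [stdSymplectic_neg_left, stdSymplectic_neg_right] at this
    linarith
  -- `x_{ai}' = -y_{ai} - x_{a(i+1)}`, where the second term is absent at the end of the row. The
  -- curvature terms drop out because `u` is orthogonal to the vertical vectors.
  have hx : ∀ t ∈ J, ∀ (a i : ℕ) (hb : (a, i) ∈ Y.cells) (h' : (a, i + 1) ∈ Y.cells),
      HasDerivAt (fun s => stdSymplectic (u s) (f ⟨(a, i), hb⟩ s))
        (-stdSymplectic (Z (c t)) (f ⟨(a, i), hb⟩ t)
          - stdSymplectic (u t) (f ⟨(a, i + 1), h'⟩ t)) t := by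
    intro t ht a i hb h'
    refine (hasDerivAt_stdSymplectic_lie (hL t ht _ _) (hE t ht)
      (h.deriv_f t ht a i hb h')).congr_deriv ?_
    rw [stdSymplectic_neg_left, stdSymplectic_sub_right, stdSymplectic_sum_right]
    simp only [stdSymplectic_smul_right, hue t ht, mul_zero, Finset.sum_const_zero]
    ring
  have hx_last : ∀ t ∈ J, ∀ (a i : ℕ) (hb : (a, i) ∈ Y.cells), (a, i + 1) ∉ Y.cells →
      HasDerivAt (fun s => stdSymplectic (u s) (f ⟨(a, i), hb⟩ s))
        (-stdSymplectic (Z (c t)) (f ⟨(a, i), hb⟩ t)) t := by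
    intro t ht a i hb h'
    refine (hasDerivAt_stdSymplectic_lie (hL t ht _ _) (hE t ht)
      (h.deriv_f_last t ht a i hb h')).congr_deriv ?_
    rw [stdSymplectic_neg_left, stdSymplectic_sum_right]
    simp only [stdSymplectic_smul_right, hue t ht, mul_zero, Finset.sum_const_zero]
    ring
  -- A second expression, `x_{a0}' = y_{a0}`, obtained by differentiating `σ(Z, e_{a0}) = -x_{a0}`.
  -- It has the sign opposite to that of `y_{a0}` in `hx` and `hx_last`.
  have hx_zero : ∀ t ∈ J, ∀ (a : ℕ) (hb : (a, 0) ∈ Y.cells),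
      HasDerivAt (fun s => stdSymplectic (u s) (f ⟨(a, 0), hb⟩ s))
        (stdSymplectic (Z (c t)) (f ⟨(a, 0), hb⟩ t)) t := by
    intro t ht a hb
    have h1 := hasDerivAt_stdSymplectic_lie (hL t ht _ _) (hH t ht) (h.deriv_e_zero t ht a hb)
    rw [stdSymplectic_zero_left, zero_add, stdSymplectic_neg_right] at h1
    have h2 := h1.neg
    rw [neg_neg] at h2
    refine h2.congr_of_eventuallyEq (Filter.eventually_of_mem (hJ.mem_nhds ht) fun s hs => ?_)
    simp only [Pi.neg_apply]
    rw [he_zero s hs a hb, neg_neg]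
  -- In a row of length at least two, the derivative of `σ(Z, e_{a1}) = 0` is `σ(Z, e_{a0}) = 0`,
  -- that is, `x_{a0} = 0`.
  have hx_long : ∀ t ∈ J, ∀ (a : ℕ) (hb : (a, 0) ∈ Y.cells), (a, 1) ∈ Y.cells →
      stdSymplectic (u t) (f ⟨(a, 0), hb⟩ t) = 0 := by
    intro t ht a hb h'
    have h1 := (hasDerivAt_stdSymplectic_lie (hL t ht _ _) (hH t ht)
      (h.deriv_e_succ t ht a 0 hb h')).eq_zero_of_eqOn hJ ht fun s hs => he_succ s hs a 0 h'
    rw [stdSymplectic_zero_left, zero_add] at h1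
    have := he_zero t ht a hb
    linarith
  have hy : ∀ t ∈ J, ∀ (a i : ℕ) (hb : (a, i) ∈ Y.cells) (h' : (a, i + 1) ∈ Y.cells),
      (a, i + 2) ∈ Y.cells →
      HasDerivAt (fun s => stdSymplectic (Z (c s)) (f ⟨(a, i), hb⟩ s))
        (-stdSymplectic (Z (c t)) (f ⟨(a, i + 1), h'⟩ t)) t := by
    intro t ht a i hb h' h''
    refine (hasDerivAt_stdSymplectic_lie (hL t ht _ _) (hH t ht)
      (h.deriv_f t ht a i hb h')).congr_deriv ?_
    rw [stdSymplectic_zero_left, stdSymplectic_sub_right, stdSymplectic_sum_right,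
      Finset.sum_eq_zero]
    · ring
    -- Only the first box of a row of length one can pair nontrivially with `Z`, and `R_eq_zero`
    -- kills the corresponding entry since `(a, i + 2)` is still in the diagram.
    · rintro ⟨⟨a', j⟩, hb'⟩ -
      rw [stdSymplectic_smul_right]
      obtain _ | j := j
      · by_cases h1 : (a', 1) ∈ Y.cells
        · rw [he_zero t ht, hx_long t ht a' hb' h1, neg_zero, mul_zero]
        · rw [R_eq_zero (h.normal t ht) hb hb' h'' h1, zero_mul]
      · rw [he_succ t ht, mul_zero]
  obtain ⟨⟨a, i⟩, hb⟩ := b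
  have hb0 : (a, 0) ∈ Y.cells := Y.up_left_mem le_rfl (Nat.zero_le i) hb
  by_cases h1 : (a, 1) ∈ Y.cells
  -- Induction along a long row: `x_{a(i+1)} = -x_{ai}' - y_{ai}` and `y_{a(i+1)} = -y_{ai}'`. The
  -- second relation stops one box before the end of the row, where `hx_last` takes over.
  · have main : ∀ (i : ℕ) (hb : (a, i) ∈ Y.cells), ∀ t ∈ J,
        stdSymplectic (u t) (f ⟨(a, i), hb⟩ t) = 0 ∧
        ((a, i + 1) ∈ Y.cells → stdSymplectic (Z (c t)) (f ⟨(a, i), hb⟩ t) = 0) := by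
      intro i
      induction i with
      | zero => exact fun hb t ht => ⟨hx_long t ht a hb h1, fun _ =>
          (hx_zero t ht a hb).eq_zero_of_eqOn hJ ht fun s hs => hx_long s hs a hb h1⟩
      | succ i ih =>
        intro hb t ht
        have hb' : (a, i) ∈ Y.cells := Y.up_left_mem le_rfl (Nat.le_succ i) hb
        refine ⟨?_, fun h' => ?_⟩
        · have e1 := (hx t ht a i hb' hb).eq_zero_of_eqOn hJ ht fun s hs => (ih hb' s hs).1
          rw [(ih hb' t ht).2 hb] at e1
          linarith
        · have e1 := (hy t ht a i hb' hb h').eq_zero_of_eqOn hJ ht fun s hs => (ih hb' s hs).2 hb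
          linarith
    by_cases h' : (a, i + 1) ∈ Y.cells
    · exact (main i hb t ht).2 h'
    · have e1 := (hx_last t ht a i hb h').eq_zero_of_eqOn hJ ht fun s hs => (main i hb s hs).1
      linarith
  · obtain rfl : i = 0 := by
      by_contra hi
      exact h1 (Y.up_left_mem le_rfl (Nat.one_le_iff_ne_zero.2 hi) hb)
    -- In a row of length one, `x' = y` and `x' = -y`.
    have e1 := (hx_zero t ht a hb).unique (hx_last t ht a 0 hb h1)
    linarith

/-- The horizontal distribution, which is the graph of `Γ`, is Lagrangian and contains the
Hamiltonian field. -/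
theorem lagrangian_of_mem_span {k : ℕ} {X : Fin k → E → E}
    (h : IsFlatFrame (flatHamField X) c Y e f R J) (hJ : IsOpen J)
    (hX : ∀ t ∈ J, ∀ i, ContDiffAt ℝ ∞ (X i) (c t).1) {t : ℝ} (ht : t ∈ J)
    {Γ : E →L[ℝ] E →L[ℝ] ℝ}
    (hΓ : ∀ u, ((u, Γ u) : E × (E →L[ℝ] ℝ)) ∈ Submodule.span ℝ (Set.range fun b => f b t)) :
    (∀ u v, Γ u v = Γ v u) ∧ (flatHamField X (c t)).2 = Γ (flatHamField X (c t)).1 := by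
  have key : ∀ v : E × (E →L[ℝ] ℝ), (∀ b, stdSymplectic v (f b t) = 0) →
      ∀ u, stdSymplectic v (u, Γ u) = 0 := by
    intro v hv u
    obtain ⟨α, hα⟩ := (Submodule.mem_span_range_iff_exists_fun ℝ).1 (hΓ u)
    rw [← hα, stdSymplectic_sum_right]
    exact Finset.sum_eq_zero fun b _ => by rw [stdSymplectic_smul_right, hv, mul_zero]
  have hsymm : ∀ u v, Γ u v = Γ v u := by
    intro u v
    have := key (u, Γ u) (fun b => by
      rw [stdSymplectic_swap, key _ (h.darboux_ff t ht b) u, neg_zero]) v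
    simp only [stdSymplectic] at this
    linarith
  refine ⟨hsymm, ?_⟩
  ext u
  -- Orthogonality of the field `Z` to the graph reads `Z.2 u = Γ u Z.1`; the symmetry of `Γ` turns
  -- this into membership in the graph.
  have := key _ (h.stdSymplectic_field_f hJ hX ht) u
  simp only [stdSymplectic] at this
  rw [hsymm]
  linarith

/-- The curvature matrix of a canonical frame computed by means of the bracket of the Hamiltonian
field with a horizontal field. -/
theorem sum_R_eq {k : ℕ} {X : Fin k → E → E}
    (h : IsFlatFrame (flatHamField X) c Y e f R J) (hJ : IsOpen J)
    (hX : ∀ t ∈ J, ∀ i, ContDiffAt ℝ ∞ (X i) (c t).1) {t : ℝ} (ht : t ∈ J)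
    {V : E × (E →L[ℝ] ℝ) → E × (E →L[ℝ] ℝ)} (hV : DifferentiableAt ℝ V (c t))
    (hVf : ∀ s ∈ J, ∀ b, stdSymplectic (V (c s)) (f b s) = 0) {α β : Y.cells → ℝ}
    (hα : ∑ b, α b • f b t = V (c t)) :
    ∑ b, ∑ b', R t b b' * α b * β b' =
      stdSymplectic (fderiv ℝ V (c t) (flatHamField X (c t))
        - fderiv ℝ (flatHamField X) (c t) (V (c t))) (∑ b, β b • f b t) := by
  set Z := flatHamField X
  have hV' : HasDerivAt (fun s => V (c s)) ((fderiv ℝ V (c t) (Z (c t))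
      - fderiv ℝ Z (c t) (V (c t))) + fderiv ℝ Z (c t) (V (c t))) t := by
    rw [sub_add_cancel]
    exact hV.hasFDerivAt.comp_hasDerivAt t (h.integral t ht)
  have hVe : ∀ b, stdSymplectic (V (c t)) (e b t) = - α b := by
    intro b
    rw [← hα, stdSymplectic_sum_left, Finset.sum_eq_single b]
    · rw [stdSymplectic_smul_left, stdSymplectic_swap, h.darboux_ef t ht, if_pos rfl]
      ring
    · intro b' _ hb'
      rw [stdSymplectic_smul_left, stdSymplectic_swap, h.darboux_ef t ht, if_neg hb'.symm]
      ring
    · simp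
  have key : ∀ b', stdSymplectic (fderiv ℝ V (c t) (Z (c t)) - fderiv ℝ Z (c t) (V (c t))) (f b' t)
      = ∑ b, R t b' b * α b := by
    intro b'
    obtain ⟨g, hg, hg0⟩ := h.hasDerivAt_f ht b'
    -- The derivative of `σ(V, f_{b'}) = 0`: the bracket of the Hamiltonian field with `V` enters as
    -- the Lie derivative of `V`, and the matrix `R` through the structural equation for `f_{b'}`.
    have e1 := (hasDerivAt_stdSymplectic_lie
      (stdSymplectic_fderiv_flatHamField (hX t ht) _ _) hV' hg).eq_zero_of_eqOn hJ ht
      fun s hs => hVf s hs b'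
    have e2 : stdSymplectic (V (c t)) g = 0 := by
      rcases hg0 with rfl | ⟨b'', rfl⟩
      · simp [stdSymplectic]
      · exact hVf t ht b''
    rw [stdSymplectic_sub_right, e2, stdSymplectic_sum_right] at e1
    simp only [stdSymplectic_smul_right, hVe, mul_neg, Finset.sum_neg_distrib] at e1
    linarith
  rw [stdSymplectic_sum_right, Finset.sum_comm]
  refine Finset.sum_congr rfl fun b' _ => ?_
  rw [stdSymplectic_smul_right, key, Finset.mul_sum]
  refine Finset.sum_congr rfl fun b _ => ?_
  rw [(h.normal t ht).symm b b']
  ring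

end IsFlatFrame

theorem symm_of_mem_closure {Γ : E × (E →L[ℝ] ℝ) → E →L[ℝ] E →L[ℝ] ℝ} {z₀ : E × (E →L[ℝ] ℝ)}
    (hΓ : ContinuousAt Γ z₀) {N : Set (E × (E →L[ℝ] ℝ))} (hz₀ : z₀ ∈ closure N)
    (hsymm : ∀ z ∈ N, ∀ u v, Γ z u v = Γ z v u) (u v : E) : Γ z₀ u v = Γ z₀ v u := by
  have hne : (𝓝[N] z₀).NeBot := mem_closure_iff_nhdsWithin_neBot.1 hz₀
  have h1 : ∀ u v, Filter.Tendsto (fun z => Γ z u v) (𝓝[N] z₀) (𝓝 (Γ z₀ u v)) := fun u v =>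
    ((hΓ.clm_apply continuousAt_const).clm_apply continuousAt_const).mono_left
      nhdsWithin_le_nhds
  exact tendsto_nhds_unique (l := 𝓝[N] z₀) ((h1 u v).congr'
    (Filter.eventually_of_mem self_mem_nhdsWithin fun z hz => hsymm z hz u v)) (h1 v u)

/-- At a limit of points where the graph of `Γ` is Lagrangian and contains the field `Z`, the bracket
with `Z` may be replaced by the bracket with the horizontal field that projects to `T`. -/
theorem stdSymplectic_bracket_eq {Z : E × (E →L[ℝ] ℝ) → E × (E →L[ℝ] ℝ)}
    {Γ : E × (E →L[ℝ] ℝ) → E →L[ℝ] E →L[ℝ] ℝ} {z₀ : E × (E →L[ℝ] ℝ)}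
    (hZ : ContDiffAt ℝ 1 Z z₀) (hΓ : ContDiffAt ℝ 1 Γ z₀) {N : Set (E × (E →L[ℝ] ℝ))}
    (hN : IsOpen N) (hz₀ : z₀ ∈ closure N) (hsymm : ∀ z ∈ N, ∀ u v, Γ z u v = Γ z v u)
    (hhor : ∀ z ∈ N, (Z z).2 = Γ z (Z z).1) {T : E → E} (hT : DifferentiableAt ℝ T z₀.1)
    (hT0 : T z₀.1 = (Z z₀).1) (V : E × (E →L[ℝ] ℝ) → E × (E →L[ℝ] ℝ)) (u : E) :
    let L : E × (E →L[ℝ] ℝ) → E × (E →L[ℝ] ℝ) := fun z => (T z.1, Γ z (T z.1))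
    stdSymplectic (fderiv ℝ V z₀ (L z₀) - fderiv ℝ L z₀ (V z₀)) (u, Γ z₀ u) =
      stdSymplectic (fderiv ℝ V z₀ (Z z₀) - fderiv ℝ Z z₀ (V z₀)) (u, Γ z₀ u) := by
  intro L
  have hne : (𝓝[N] z₀).NeBot := mem_closure_iff_nhdsWithin_neBot.1 hz₀
  have hsymm₀ := symm_of_mem_closure hΓ.continuousAt hz₀ hsymm
  -- This function measures the failure of `Z` to be horizontal. It vanishes on the open set `N`,
  -- together with its derivative, and both are continuous at `z₀`; so both vanish at `z₀`.
  have hG : ContDiffAt ℝ 1 (fun z => (Z z).2 - Γ z (Z z).1) z₀ :=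
    hZ.snd.sub (hΓ.clm_apply hZ.fst)
  have hG0 : (Z z₀).2 - Γ z₀ (Z z₀).1 = 0 :=
    tendsto_nhds_unique (l := 𝓝[N] z₀) (hG.continuousAt.mono_left nhdsWithin_le_nhds)
      (tendsto_const_nhds.congr' (Filter.eventually_of_mem self_mem_nhdsWithin fun z hz => by
        simp [hhor z hz]))
  have hG1 : fderiv ℝ (fun z => (Z z).2 - Γ z (Z z).1) z₀ = 0 := by
    have h1 : ContinuousAt (fderiv ℝ (fun z => (Z z).2 - Γ z (Z z).1)) z₀ :=
      (hG.fderiv_right (m := 0) (by norm_num)).continuousAt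
    refine tendsto_nhds_unique (l := 𝓝[N] z₀) (h1.mono_left nhdsWithin_le_nhds)
      (tendsto_const_nhds.congr' (Filter.eventually_of_mem self_mem_nhdsWithin fun z hz => ?_))
    have : (fun z => (Z z).2 - Γ z (Z z).1) =ᶠ[𝓝 z] fun _ => 0 :=
      Filter.eventually_of_mem (hN.mem_nhds hz) fun z hz => by simp [hhor z hz]
    rw [this.fderiv_eq]
    simp
  have hL0 : L z₀ = Z z₀ := by
    ext1
    · exact hT0
    · simp only [L, hT0]; rw [sub_eq_zero] at hG0; exact hG0.symm
  rw [hL0, ← sub_eq_zero, ← stdSymplectic_sub_left, sub_sub_sub_cancel_left]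
  set w := V z₀
  have hZd := (hZ.differentiableAt one_ne_zero).hasFDerivAt
  have hΓd := (hΓ.differentiableAt one_ne_zero).hasFDerivAt
  have hTd : HasFDerivAt (fun z : E × (E →L[ℝ] ℝ) => T z.1)
      ((fderiv ℝ T z₀.1).comp (ContinuousLinearMap.fst ℝ E (E →L[ℝ] ℝ))) z₀ :=
    hT.hasFDerivAt.comp z₀ hasFDerivAt_fst
  have hLd : HasFDerivAt L _ z₀ := hTd.prodMk (hΓd.clm_apply hTd)
  have hGd := hZd.snd.sub (hΓd.clm_apply hZd.fst)
  have e1 := congrArg (fun A => A w) (hGd.fderiv.symm.trans hG1)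
  -- Both `Z` and `L` satisfy this relation with the same term `fderiv ℝ Γ z₀ w (Z z₀).1`, as they
  -- agree at `z₀`. The difference of their derivatives is therefore in the graph of `Γ z₀`, which
  -- is Lagrangian.
  have e2 : (fderiv ℝ Z z₀ w).2 = Γ z₀ (fderiv ℝ Z z₀ w).1 + fderiv ℝ Γ z₀ w (Z z₀).1 := by
    rw [← sub_eq_zero]
    simpa using e1
  rw [hLd.fderiv]
  simp only [stdSymplectic, ContinuousLinearMap.prod_apply, Prod.fst_sub, Prod.snd_sub, e2, hT0,
    ContinuousLinearMap.comp_apply, add_apply, ContinuousLinearMap.flip_apply, sub_apply,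
    ContinuousLinearMap.coe_fst', map_sub]
  rw [hsymm₀ u, hsymm₀ u]
  ring

end FlatFrame

/-! ## Coordinate expressions -/

section Coordinates

variable {V : Type*} [NormedAddCommGroup V] [NormedSpace ℝ V] {H : Type*} [TopologicalSpace H]
  (I : ModelWithCorners ℝ V H) {P : Type*} [TopologicalSpace P] [ChartedSpace H P]

/-- The differential at `q` of the chart at `p`. -/
def dchart (p q : P) : TangentSpace I q →L[ℝ] V := mfderiv I 𝓘(ℝ, V) (extChartAt I p) q

/-- The coordinate expression of a vector field in the chart at `p`. -/
def coordField (p : P) (X : ∀ q : P, TangentSpace I q) (z : V) : V :=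
  dchart I p ((extChartAt I p).symm z) (X ((extChartAt I p).symm z))

theorem coordField_apply {p q : P} (hq : q ∈ (extChartAt I p).source)
    (X : ∀ q : P, TangentSpace I q) :
    coordField I p X (extChartAt I p q) = dchart I p q (X q) := by
  have key : ∀ q', q' = q → dchart I p q' (X q') = dchart I p q (X q) := by
    rintro _ rfl
    rfl
  exact key _ ((extChartAt I p).left_inv hq)

variable [IsManifold I ∞ P]

theorem dchart_bijective {p q : P} (hq : q ∈ (extChartAt I p).source) :
    Function.Bijective (dchart I p q) := by
  obtain ⟨A, hA⟩ := isInvertible_mfderiv_extChartAt (I := I) hq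
  change Function.Bijective (mfderiv I 𝓘(ℝ, V) (extChartAt I p) q)
  rw [← hA]
  exact A.bijective

/-- The differential of the chart at `p` is the trivialization of the tangent bundle at `p`, and
smoothness of a section may be tested in a trivialization. -/
theorem contDiffAt_coordField [I.Boundaryless] {p q : P} (hq : q ∈ (extChartAt I p).source)
    {X : ∀ q : P, TangentSpace I q} {s : Set P} (hX : SmoothFieldOn I X s) (hs : s ∈ 𝓝 q) :
    ContDiffAt ℝ ∞ (coordField I p X) (extChartAt I p q) := by
  have hq' : q ∈ (chartAt H p).source := by simpa using hq
  have h1 : ContMDiffAt I I.tangent ∞ (fun p => (⟨p, X p⟩ : TangentBundle I P)) q :=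
    (hX q (mem_of_mem_nhds hs)).contMDiffAt hs
  have h2 := ((trivializationAt V (TangentSpace I) p).contMDiffAt_section_iff (IB := I)
    (n := ∞) (s := X) (x₀ := q) hq').1 h1
  have h3 : ContMDiffAt I 𝓘(ℝ, V) ∞ (fun q => dchart I p q (X q)) q := by
    refine h2.congr_of_eventuallyEq ?_
    filter_upwards [(chartAt H p).open_source.mem_nhds hq'] with y hy
    have := TangentBundle.continuousLinearMapAt_trivializationAt (𝕜 := ℝ) (I := I) hy
    rw [dchart, ← this]
    exact congrFun (((trivializationAt V (TangentSpace I) p).coe_linearMapAt_of_mem (R := ℝ) hy)) _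
  have h4 : ContMDiffAt 𝓘(ℝ, V) I ∞ (extChartAt I p).symm (extChartAt I p q) :=
    (contMDiffOn_extChartAt_symm p).contMDiffAt
      (extChartAt_target_mem_nhds' ((extChartAt I p).map_source hq))
  have h5 := ContMDiffAt.comp (extChartAt I p q)
    (g := fun q => dchart I p q (X q)) (f := (extChartAt I p).symm)
    (by rw [(extChartAt I p).left_inv hq]; exact h3) h4
  exact h5.contDiffAt

theorem contDiffAt_coordFieldAlong {p : P} {c : ℝ → P}
    {X : ∀ t, TangentSpace I (c t)} {s : Set ℝ} {t : ℝ} (hX : SmoothFieldAlongOn I c X s)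
    (hs : s ∈ 𝓝 t) (hq : c t ∈ (extChartAt I p).source) :
    ContDiffAt ℝ ∞ (fun t => dchart I p (c t) (X t)) t := by
  have hq' : c t ∈ (chartAt H p).source := by simpa using hq
  have h1 : ContMDiffAt 𝓘(ℝ, ℝ) I.tangent ∞ (fun t => (⟨c t, X t⟩ : TangentBundle I P)) t :=
    (hX t (mem_of_mem_nhds hs)).contMDiffAt hs
  have h2 := (((trivializationAt V (TangentSpace I) p).contMDiffAt_iff (IB := I) (IM := 𝓘(ℝ, ℝ))
    (n := ∞) (f := fun t => (⟨c t, X t⟩ : TangentBundle I P)) (x₀ := t)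
    (by simpa [TangentBundle.trivializationAt_source] using hq')).1 h1)
  have hc : ContinuousAt c t := h2.1.continuousAt
  have h3 : ContMDiffAt 𝓘(ℝ, ℝ) 𝓘(ℝ, V) ∞ (fun t => dchart I p (c t) (X t)) t := by
    refine h2.2.congr_of_eventuallyEq ?_
    filter_upwards [hc.preimage_mem_nhds ((chartAt H p).open_source.mem_nhds hq')] with y hy
    have := TangentBundle.continuousLinearMapAt_trivializationAt (𝕜 := ℝ) (I := I) hy
    rw [dchart, ← this]
    exact congrFun (((trivializationAt V (TangentSpace I) p).coe_linearMapAt_of_mem (R := ℝ) hy)) _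
  exact h3.contDiffAt

theorem hasDerivAt_coordCurve {p : P} {c : ℝ → P} {Z : ∀ q : P, TangentSpace I q} {s : Set ℝ}
    {t : ℝ} (hc : IsMIntegralCurveOn c Z s) (hs : s ∈ 𝓝 t)
    (hq : c t ∈ (extChartAt I p).source) :
    HasDerivAt (fun t => extChartAt I p (c t)) (dchart I p (c t) (Z (c t))) t := by
  have hq' : c t ∈ (chartAt H p).source := by simpa using hq
  have h1 := (hc t (mem_of_mem_nhds hs)).hasMFDerivAt hs
  have h2 : HasMFDerivAt I 𝓘(ℝ, V) (extChartAt I p) (c t)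
      (mfderiv I 𝓘(ℝ, V) (extChartAt I p) (c t)) :=
    (mdifferentiableAt_extChartAt hq').hasMFDerivAt
  have h3 : HasFDerivAt (fun t => extChartAt I p (c t)) ((dchart I p (c t)).comp
      (ContinuousLinearMap.smulRight (1 : ℝ →L[ℝ] ℝ) (Z (c t)))) t := (h2.comp t h1).hasFDerivAt
  refine h3.hasDerivAt.congr_deriv ?_
  change dchart I p (c t) ((1 : ℝ) • Z (c t)) = _
  rw [one_smul]

omit [IsManifold I ∞ P] in
theorem continuousAt_of_isMIntegralCurveOn {c : ℝ → P} {Z : ∀ q : P, TangentSpace I q}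
    {s : Set ℝ} {t : ℝ} (hc : IsMIntegralCurveOn c Z s) (hs : s ∈ 𝓝 t) : ContinuousAt c t :=
  ((hc t (mem_of_mem_nhds hs)).hasMFDerivAt hs).continuousAt

/-- The manifold bracket at `p` is defined by pulling back to the chart at `p`, where the
pulled-back fields are near the centre the coordinate expressions. The formula is needed only at the
centre of the chart. -/
theorem dchart_mlieBracket [I.Boundaryless] (p : P) (X Y : ∀ q : P, TangentSpace I q) :
    dchart I p p (VectorField.mlieBracket I X Y p) =
      fderiv ℝ (coordField I p Y) (extChartAt I p p) (coordField I p X (extChartAt I p p))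
      - fderiv ℝ (coordField I p X) (extChartAt I p p) (coordField I p Y (extChartAt I p p)) := by
  have hinv := isInvertible_mfderiv_extChartAt (I := I) (mem_extChartAt_source (I := I) p)
  have key : ∀ X : ∀ q : P, TangentSpace I q,
      VectorField.mpullbackWithin 𝓘(ℝ, V) I (extChartAt I p).symm X (Set.range I)
        =ᶠ[𝓝 (extChartAt I p p)] coordField I p X := by
    intro X
    filter_upwards [extChartAt_target_mem_nhds (I := I) p] with z hz
    rw [VectorField.mpullbackWithin_apply]
    have h1 := mfderivWithin_extChartAt_symm_comp_mfderiv_extChartAt (I := I) hz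
    have h2 := mfderiv_extChartAt_comp_mfderivWithin_extChartAt_symm (I := I) hz
    rw [ContinuousLinearMap.inverse_eq h1 h2]
    rfl
  rw [← VectorField.mlieBracketWithin_univ, VectorField.mlieBracketWithin_apply]
  have h3 : ∀ v : V, dchart I p p ((mfderiv I 𝓘(ℝ, V) (extChartAt I p) p).inverse v) = v := by
    intro v
    obtain ⟨A, hA⟩ := hinv
    change (mfderiv I 𝓘(ℝ, V) (extChartAt I p) p) _ = v
    rw [← hA, ContinuousLinearMap.inverse_equiv]
    exact A.apply_symm_apply v
  refine (h3 _).trans ?_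
  have h4 : (extChartAt I p).symm ⁻¹' Set.univ ∩ Set.range I = Set.univ := by
    simp [I.range_eq_univ]
  rw [h4]
  have h5 : ∀ A B A' B' : V → V, A =ᶠ[𝓝 (extChartAt I p p)] A' → B =ᶠ[𝓝 (extChartAt I p p)] B' →
      VectorField.lieBracketWithin ℝ A B Set.univ (extChartAt I p p) =
      fderiv ℝ B' (extChartAt I p p) (A' (extChartAt I p p))
      - fderiv ℝ A' (extChartAt I p p) (B' (extChartAt I p p)) := by
    intro A B A' B' hA hB
    rw [VectorField.lieBracketWithin_univ, hA.lieBracket_vectorField_eq hB]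
    rfl
  exact h5 _ _ _ _ (key X) (key Y)

/-- Passes from the invariant Lie derivative, computed in the chart at `c t`, to the expression in a
fixed chart around a piece of the curve. The inverse flow `Ψ`, read from the chart at `p` to the
chart at `c t`, is constant to first order along `Z`, so `hasDerivAt_fderiv_flow` applies. -/
theorem dchart_lieDeriv [I.Boundaryless] {p : P} {Z : ∀ q : P, TangentSpace I q} {c : ℝ → P}
    {X : ∀ t, TangentSpace I (c t)} {s : Set ℝ} {t : ℝ} {W : TangentSpace I (c t)}
    (hW : HasLieDerivAlong I Z c X t W) (hc : IsMIntegralCurveOn c Z s) (hs : s ∈ 𝓝 t)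
    (hq : c t ∈ (extChartAt I p).source)
    (hZ : DifferentiableAt ℝ (coordField I p Z) (extChartAt I p (c t)))
    (hX : SmoothFieldAlongOn I c X s) :
    HasDerivAt (fun t => dchart I p (c t) (X t)) (dchart I p (c t) W
      + fderiv ℝ (coordField I p Z) (extChartAt I p (c t)) (dchart I p (c t) (X t))) t := by
  obtain ⟨φ, δ, O, hφ, hder⟩ := hW
  have hXd : DifferentiableAt ℝ (fun t => dchart I p (c t) (X t)) t :=
    (contDiffAt_coordFieldAlong I hX hs hq).differentiableAt (by simp)
  set χ := extChartAt I p with hχ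
  set χ₁ := extChartAt I (c t) with hχ₁
  set Ψ : ℝ × V → V := fun z => χ₁ (φ (-z.1) (χ.symm z.2)) with hΨ_def
  have hsrc₁ : c t ∈ (chartAt H (c t)).source := mem_chart_source H (c t)
  have hIoo : Set.Ioo (-δ) δ ∈ 𝓝 (0 : ℝ) := Ioo_mem_nhds (by linarith [hφ.pos]) hφ.pos
  have hΨ : ContDiffAt ℝ ∞ Ψ (0, χ (c t)) := by
    have h4 : ContMDiffAt 𝓘(ℝ, V) I ∞ χ.symm (χ (c t)) :=
      (contMDiffOn_extChartAt_symm p).contMDiffAt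
        (extChartAt_target_mem_nhds' (χ.map_source hq))
    have h1 : ContMDiffAt 𝓘(ℝ, ℝ × V) (𝓘(ℝ, ℝ).prod I) ∞
        (fun z : ℝ × V => (-z.1, χ.symm z.2)) (0, χ (c t)) :=
      (contDiff_fst.neg.contMDiff.contMDiffAt).prodMk
        (ContMDiffAt.comp ((0 : ℝ), χ (c t)) (g := χ.symm) (f := Prod.snd) h4
          contDiff_snd.contMDiff.contMDiffAt)
    have h2 : ContMDiffAt (𝓘(ℝ, ℝ).prod I) I ∞ (fun z : ℝ × P => φ z.1 z.2) (0, c t) :=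
      (hφ.smooth (0, c t) ⟨mem_of_mem_nhds hIoo, hφ.mem⟩).contMDiffAt
        (prod_mem_nhds hIoo (hφ.isOpen.mem_nhds hφ.mem))
    have h3 : ContMDiffAt I 𝓘(ℝ, V) ∞ χ₁ (φ 0 (c t)) := by
      rw [hφ.init _ hφ.mem]
      exact contMDiffAt_extChartAt
    have h5 := ContMDiffAt.comp (I' := 𝓘(ℝ, ℝ).prod I) ((0 : ℝ), χ (c t))
      (g := fun z : ℝ × P => χ₁ (φ z.1 z.2))
      (f := fun z : ℝ × V => (-z.1, χ.symm z.2))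
      (by simp only [neg_zero, χ.left_inv hq]; exact ContMDiffAt.comp ((0 : ℝ), c t) h3 h2) h1
    exact h5.contDiffAt
  have hΨd : ∀ᶠ z in 𝓝 ((0 : ℝ), χ (c t)), DifferentiableAt ℝ Ψ z :=
    ((hΨ.of_le (m := 1) (by norm_cast)).eventually (by simp)).mono
      fun z hz => hz.differentiableAt one_ne_zero
  have hcc : ContinuousAt c t := continuousAt_of_isMIntegralCurveOn I hc hs
  have hct : HasDerivAt (fun s => χ (c (t + s))) (dchart I p (c t) (Z (c t))) 0 := by
    have := hasDerivAt_coordCurve I hc hs hq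
    have h := HasDerivAt.comp_const_add (f := fun t => χ (c t)) t 0 (by rw [add_zero]; exact this)
    exact h
  have hsource : ∀ᶠ q in 𝓝 (c t), q ∈ χ.source :=
    (isOpen_extChartAt_source p).mem_nhds hq
  -- the partial differential of `Ψ`
  have hpart : ∀ (σ : ℝ) (q : P), q ∈ χ.source → DifferentiableAt ℝ Ψ (σ, χ q) →
      ∀ v : TangentSpace I q, (mfderiv I 𝓘(ℝ, V) (fun q => χ₁ (φ (-σ) q)) q v : V)
        = fderiv ℝ Ψ (σ, χ q) (0, dchart I p q v) := by
    intro σ q hqs hd v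
    have h1 : HasFDerivAt (fun z : V => Ψ (σ, z))
        ((fderiv ℝ Ψ (σ, χ q)).comp (ContinuousLinearMap.inr ℝ ℝ V)) (χ q) := by
      have := (hasFDerivAt_const σ (χ q)).prodMk (hasFDerivAt_id (𝕜 := ℝ) (χ q))
      exact hd.hasFDerivAt.comp (χ q) this
    have h2 : HasMFDerivAt I 𝓘(ℝ, V) χ q (mfderiv I 𝓘(ℝ, V) χ q) :=
      (mdifferentiableAt_extChartAt (by simpa [hχ] using hqs)).hasMFDerivAt
    have h3 := h1.hasMFDerivAt.comp q h2
    have h4 : (fun q => χ₁ (φ (-σ) q)) =ᶠ[𝓝 q] (fun z : V => Ψ (σ, z)) ∘ χ := by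
      filter_upwards [(isOpen_extChartAt_source (I := I) p).mem_nhds hqs] with y hy
      simp only [hΨ_def, Function.comp, χ.left_inv hy]
    rw [(h3.congr_of_eventuallyEq h4).mfderiv]
    rfl
  -- The flow runs backwards in the first variable, so the time derivative of `Ψ` at time zero is
  -- minus its space derivative along `Z`.
  have h0 : ∀ᶠ z in 𝓝 (χ (c t)), fderiv ℝ Ψ (0, z) (1, coordField I p Z z) = 0 := by
    have e1 : ∀ᶠ z in 𝓝 (χ (c t)), DifferentiableAt ℝ Ψ (0, z) :=
      (Continuous.prodMk_right (0 : ℝ)).continuousAt.eventually hΨd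
    have e2 : ∀ᶠ z in 𝓝 (χ (c t)), z ∈ χ.target :=
      extChartAt_target_mem_nhds' (χ.map_source hq)
    have e3 : ContinuousAt χ.symm (χ (c t)) := continuousAt_extChartAt_symm' hq
    have e4 : ∀ᶠ z in 𝓝 (χ (c t)), χ.symm z ∈ O :=
      e3.preimage_mem_nhds (by rw [χ.left_inv hq]; exact hφ.isOpen.mem_nhds hφ.mem)
    have e5 : ∀ᶠ z in 𝓝 (χ (c t)), χ.symm z ∈ χ₁.source :=
      e3.preimage_mem_nhds (by rw [χ.left_inv hq]; exact extChartAt_source_mem_nhds (c t))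
    filter_upwards [e1, e2, e4, e5] with z hz1 hz2 hz4 hz5
    obtain ⟨q, hqs, rfl⟩ : ∃ q ∈ χ.source, χ q = z :=
      ⟨χ.symm z, χ.map_target hz2, χ.right_inv hz2⟩
    rw [χ.left_inv hqs] at hz4 hz5
    have hinit : φ 0 q = q := hφ.init q hz4
    have f1 : fderiv ℝ Ψ (0, χ q) (0, coordField I p Z (χ q)) = dchart I (c t) q (Z q) := by
      rw [coordField_apply I hqs, ← hpart 0 q hqs hz1]
      have : (fun q => χ₁ (φ (-0) q)) =ᶠ[𝓝 q] χ₁ := by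
        filter_upwards [hφ.isOpen.mem_nhds hz4] with y hy
        rw [neg_zero, hφ.init y hy]
      rw [this.mfderiv_eq]
      rfl
    have f2 : fderiv ℝ Ψ (0, χ q) (1, 0) = - dchart I (c t) q (Z q) := by
      have g1 : HasDerivAt (fun s : ℝ => Ψ (s, χ q)) (fderiv ℝ Ψ (0, χ q) (1, 0)) 0 := by
        have := (hasDerivAt_id (0 : ℝ)).prodMk (hasDerivAt_const (0 : ℝ) (χ q))
        exact hz1.hasFDerivAt.comp_hasDerivAt (0 : ℝ) this
      have g2 := hasDerivAt_coordCurve I (p := c t) (hφ.integral q hz4) hIoo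
        (by rw [hinit]; exact hz5)
      rw [show dchart I (c t) (φ 0 q) (Z (φ 0 q)) = dchart I (c t) q (Z q) by rw [hinit]] at g2
      have g3 : HasDerivAt (fun s : ℝ => χ₁ (φ (-s) q)) (-dchart I (c t) q (Z q)) 0 := by
        have := HasDerivAt.scomp (0 : ℝ) (g₁ := fun s => χ₁ (φ s q)) (h := fun s : ℝ => -s)
          (by rw [neg_zero]; exact g2) (hasDerivAt_neg (0 : ℝ))
        simpa [Function.comp_def] using this
      refine g1.unique (g3.congr_of_eventuallyEq ?_)
      exact Filter.Eventually.of_forall fun s => by simp [hΨ_def, χ.left_inv hqs]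
    have f3 : ((1 : ℝ), coordField I p Z (χ q)) = (1, 0) + (0, coordField I p Z (χ q)) := by simp
    rw [f3, map_add, f1, f2, neg_add_cancel]
  have hXs : HasDerivAt (fun s => dchart I p (c (t + s)) (X (t + s)))
      (deriv (fun t => dchart I p (c t) (X t)) t) 0 := by
    exact HasDerivAt.comp_const_add (f := fun t => dchart I p (c t) (X t)) t 0
      (by rw [add_zero]; exact hXd.hasDerivAt)
  have hflow := hasDerivAt_fderiv_flow (Ψ := Ψ) (Z := coordField I p Z) (z₀ := χ (c t))
    (c := fun s => χ (c (t + s))) (hΨ.of_le (by norm_cast)) hZ h0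
    (by rw [coordField_apply I hq]; exact hct) (by simp) hXs
  have hev : (fun ε : ℝ => (mfderiv I 𝓘(ℝ, V) (fun q => χ₁ (φ (-ε) q)) (c (t + ε))
        (X (t + ε)) : V)) =ᶠ[𝓝 0]
      fun s => fderiv ℝ Ψ (s, χ (c (t + s))) (0, dchart I p (c (t + s)) (X (t + s))) := by
    have hadd : Filter.Tendsto (fun s => t + s) (𝓝 0) (𝓝 t) := by
      simpa using (continuous_const_add t).tendsto (0 : ℝ)
    have k1 : ∀ᶠ s in 𝓝 (0 : ℝ), c (t + s) ∈ χ.source :=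
      (hcc.tendsto.comp hadd).eventually hsource
    have k2 : ∀ᶠ s in 𝓝 (0 : ℝ), DifferentiableAt ℝ Ψ (s, χ (c (t + s))) := by
      have : ContinuousAt (fun s : ℝ => (s, χ (c (t + s)))) 0 :=
        continuousAt_id.prodMk hct.continuousAt
      have h' : Filter.Tendsto (fun s : ℝ => (s, χ (c (t + s)))) (𝓝 0) (𝓝 (0, χ (c t))) := by
        simpa [ContinuousAt] using this
      exact h'.eventually hΨd
    filter_upwards [k1, k2] with s hs1 hs2
    exact hpart s _ hs1 hs2 _
  have huniq := (hflow.congr_of_eventuallyEq hev).unique hder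
  have hd0 : ∀ v : TangentSpace I (c t), fderiv ℝ Ψ (0, χ (c t)) (0, dchart I p (c t) v)
      = dchart I (c t) (c t) v := by
    intro v
    rw [← hpart 0 (c t) hq hΨd.self_of_nhds]
    have : (fun q => χ₁ (φ (-0) q)) =ᶠ[𝓝 (c t)] χ₁ := by
      filter_upwards [hφ.isOpen.mem_nhds hφ.mem] with y hy
      rw [neg_zero, hφ.init y hy]
    rw [this.mfderiv_eq]
    rfl
  -- At time zero the space differential of `Ψ` only changes charts, so it can be cancelled by
  -- injectivity.
  have hfin : deriv (fun t => dchart I p (c t) (X t)) t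
      - fderiv ℝ (coordField I p Z) (χ (c t)) (dchart I p (c t) (X t)) = dchart I p (c t) W := by
    obtain ⟨v, hv⟩ := (dchart_bijective I hq).2 (deriv (fun t => dchart I p (c t) (X t)) t
      - fderiv ℝ (coordField I p Z) (χ (c t)) (dchart I p (c t) (X t)))
    have h00 : dchart I p (c (t + 0)) (X (t + 0)) = dchart I p (c t) (X t) :=
      congrArg (fun t => dchart I p (c t) (X t)) (add_zero t)
    rw [h00] at huniq
    rw [← hv, hd0] at huniq
    rw [← hv, (dchart_bijective I (mem_extChartAt_source (c t))).1 huniq]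
  rw [← hfin, sub_add_cancel]
  exact hXd.hasDerivAt

end Coordinates

/-! ### Changes of charts -/

section Transition

variable {V : Type*} [NormedAddCommGroup V] [NormedSpace ℝ V] {H : Type*} [TopologicalSpace H]
  (I : ModelWithCorners ℝ V H) [I.Boundaryless] {P : Type*} [TopologicalSpace P] [ChartedSpace H P]
  [IsManifold I ∞ P]

theorem contDiffAt_transition {p p' q : P} (hq : q ∈ (extChartAt I p).source)
    (hq' : q ∈ (extChartAt I p').source) :
    ContDiffAt ℝ ∞ (fun z => extChartAt I p ((extChartAt I p').symm z)) (extChartAt I p' q) := by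
  have h4 : ContMDiffAt 𝓘(ℝ, V) I ∞ (extChartAt I p').symm (extChartAt I p' q) :=
    (contMDiffOn_extChartAt_symm p').contMDiffAt
      (extChartAt_target_mem_nhds' ((extChartAt I p').map_source hq'))
  have h5 := ContMDiffAt.comp (extChartAt I p' q)
    (g := extChartAt I p) (f := (extChartAt I p').symm)
    (by rw [(extChartAt I p').left_inv hq']; exact contMDiffAt_extChartAt' (by simpa using hq)) h4
  exact h5.contDiffAt

theorem dchart_eq_fderiv_transition {p p' q : P} (hq : q ∈ (extChartAt I p).source)
    (hq' : q ∈ (extChartAt I p').source) (v : TangentSpace I q) :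
    dchart I p q v = fderiv ℝ (fun z => extChartAt I p ((extChartAt I p').symm z))
      (extChartAt I p' q) (dchart I p' q v) := by
  have h1 := ((contDiffAt_transition I hq hq').differentiableAt (by simp)).hasFDerivAt
  have h2 : HasMFDerivAt I 𝓘(ℝ, V) (extChartAt I p') q (mfderiv I 𝓘(ℝ, V) (extChartAt I p') q) :=
    (mdifferentiableAt_extChartAt (by simpa using hq')).hasMFDerivAt
  have h3 := h1.hasMFDerivAt.comp q h2
  have h4 : extChartAt I p =ᶠ[𝓝 q]
      (fun z => extChartAt I p ((extChartAt I p').symm z)) ∘ extChartAt I p' := by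
    filter_upwards [(isOpen_extChartAt_source (I := I) p').mem_nhds hq'] with y hy
    simp only [Function.comp, (extChartAt I p').left_inv hy]
  rw [dchart, (h3.congr_of_eventuallyEq h4).mfderiv]
  rfl

end Transition

/-! ## Canonical coordinates of the cotangent bundle -/

section CotangentChart

variable {E M : Type*} [NormedAddCommGroup E] [NormedSpace ℝ E] [TopologicalSpace M]
  [ChartedSpace E M] [IsManifold 𝓘(ℝ, E) ∞ M]

theorem mem_cotangentChart_source {p q : CotangentBundle E M} :
    q ∈ (extChartAt (cotangentModel E) p).source ↔ q.proj ∈ (extChartAt 𝓘(ℝ, E) p.proj).source := by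
  rw [FiberBundle.extChartAt]
  simp only [PartialEquiv.trans_source, Set.mem_inter_iff, Set.mem_preimage,
    PartialEquiv.prod_source, PartialEquiv.refl_source, Set.mem_prod, Set.mem_univ, and_true]
  have h : ∀ q : CotangentBundle E M, q.proj ∈ (chartAt E p.proj).source →
      q ∈ (trivializationAt (E →L[ℝ] ℝ)
        (fun x : M => TangentSpace 𝓘(ℝ, E) x →L[ℝ] ℝ) p.proj).source := by
    intro q hq
    rw [Bundle.Trivialization.mem_source, hom_trivializationAt_baseSet]
    exact ⟨hq, Set.mem_univ _⟩
  constructor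
  · rintro ⟨h1, h2⟩
    exact h2
  · intro h1
    exact ⟨h q (by simpa using h1), h1⟩

theorem cotangentChart_fst (p q : CotangentBundle E M) :
    (extChartAt (cotangentModel E) p q).1 = extChartAt 𝓘(ℝ, E) p.proj q.proj := by
  rw [FiberBundle.extChartAt]
  rfl

/-- The trivialization of `T*M` is dual to that of `TM`, so the pairing of covectors with vectors is
the same in coordinates. -/
theorem cotangentChart_snd {p q : CotangentBundle E M}
    (hq : q ∈ (extChartAt (cotangentModel E) p).source) (u : TangentSpace 𝓘(ℝ, E) q.proj) :
    (extChartAt (cotangentModel E) p q).2 (dchart 𝓘(ℝ, E) p.proj q.proj u) = q.snd u := by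
  have hq' : q.proj ∈ (chartAt E p.proj).source := by
    simpa using mem_cotangentChart_source.1 hq
  rw [FiberBundle.extChartAt]
  change (ContinuousLinearMap.inCoordinates E (fun x : M => TangentSpace 𝓘(ℝ, E) x) ℝ
    (fun _ : M => ℝ) p.proj q.proj p.proj q.proj q.snd) _ = _
  rw [ContinuousLinearMap.inCoordinates_eq hq' (Set.mem_univ _)]
  have h1 : dchart 𝓘(ℝ, E) p.proj q.proj u =
      (trivializationAt E (TangentSpace 𝓘(ℝ, E)) p.proj).continuousLinearEquivAt ℝ q.proj hq' u := by
    have := TangentBundle.continuousLinearMapAt_trivializationAt (𝕜 := ℝ) (I := 𝓘(ℝ, E)) hq'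
    rw [dchart, ← this]
    exact congrFun ((trivializationAt E (TangentSpace 𝓘(ℝ, E)) p.proj).coe_linearMapAt_of_mem
      (R := ℝ) hq') _
  rw [h1]
  simp only [ContinuousLinearMap.comp_apply, ContinuousLinearEquiv.coe_coe,
    ContinuousLinearEquiv.symm_apply_apply]
  rfl

theorem dchart_fst {p q : CotangentBundle E M}
    (hq : q ∈ (extChartAt (cotangentModel E) p).source)
    (v : TangentSpace (cotangentModel E) q) :
    (dchart (cotangentModel E) p q v).1 = dchart 𝓘(ℝ, E) p.proj q.proj (dproj q v) := by
  have h1 : HasMFDerivAt (cotangentModel E) 𝓘(ℝ, E × (E →L[ℝ] ℝ)) (extChartAt (cotangentModel E) p) q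
      (dchart (cotangentModel E) p q) :=
    (mdifferentiableAt_extChartAt (by simpa using hq)).hasMFDerivAt
  have h2 : HasMFDerivAt 𝓘(ℝ, E × (E →L[ℝ] ℝ)) 𝓘(ℝ, E) Prod.fst (extChartAt (cotangentModel E) p q)
      (ContinuousLinearMap.fst ℝ E (E →L[ℝ] ℝ)) := hasFDerivAt_fst.hasMFDerivAt
  have h3 : HasMFDerivAt (cotangentModel E) 𝓘(ℝ, E) (fun q : CotangentBundle E M => q.proj) q
      (dproj q) :=
    ((Bundle.contMDiff_proj (n := 1) _ q).mdifferentiableAt one_ne_zero).hasMFDerivAt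
  have h4 : HasMFDerivAt 𝓘(ℝ, E) 𝓘(ℝ, E) (extChartAt 𝓘(ℝ, E) p.proj) q.proj
      (dchart 𝓘(ℝ, E) p.proj q.proj) :=
    (mdifferentiableAt_extChartAt (by simpa using mem_cotangentChart_source.1 hq)).hasMFDerivAt
  have h5 := h2.comp q h1
  have h6 := h4.comp q h3
  have h7 : Prod.fst ∘ extChartAt (cotangentModel E) p
      = extChartAt 𝓘(ℝ, E) p.proj ∘ fun q : CotangentBundle E M => q.proj :=
    funext fun q => cotangentChart_fst p q
  rw [h7] at h5
  exact congrArg (fun L : TangentSpace (cotangentModel E) q →L[ℝ] E => L v)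
    (hasMFDerivAt_unique h5 h6)

/-- The Liouville form is `ξ dx` in each of these charts. Changes of charts therefore preserve `ξ
dx`, and with it the symplectic form. -/
theorem cotangentChart_liouville {p q : CotangentBundle E M}
    (hq : q ∈ (extChartAt (cotangentModel E) p).source)
    (v : TangentSpace (cotangentModel E) q) :
    (extChartAt (cotangentModel E) p q).2 (dchart (cotangentModel E) p q v).1 = liouville q v := by
  rw [dchart_fst hq, cotangentChart_snd hq]
  rfl

theorem symplectic_eq_self (q : CotangentBundle E M) (v w : TangentSpace (cotangentModel E) q) :
    symplectic q v w = stdSymplectic (dchart (cotangentModel E) q q v)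
      (dchart (cotangentModel E) q q w) := by
  have key : (fun z => (liouville ((extChartAt (cotangentModel E) q).symm z)).comp
      (mfderiv 𝓘(ℝ, E × (E →L[ℝ] ℝ)) (cotangentModel E) (extChartAt (cotangentModel E) q).symm z))
      =ᶠ[𝓝 (extChartAt (cotangentModel E) q q)]
      fun z => z.2.comp (ContinuousLinearMap.fst ℝ E (E →L[ℝ] ℝ)) := by
    filter_upwards [extChartAt_target_mem_nhds (I := cotangentModel E) q] with z hz
    refine ContinuousLinearMap.ext fun w => ?_
    have hs := (extChartAt (cotangentModel E) q).map_target hz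
    have h1 := cotangentChart_liouville hs (mfderiv 𝓘(ℝ, E × (E →L[ℝ] ℝ)) (cotangentModel E)
      (extChartAt (cotangentModel E) q).symm z w)
    have h2 := mfderiv_extChartAt_comp_mfderivWithin_extChartAt_symm (I := cotangentModel E) hz
    rw [ModelWithCorners.range_eq_univ, mfderivWithin_univ] at h2
    have h3 : dchart (cotangentModel E) q ((extChartAt (cotangentModel E) q).symm z)
        (mfderiv 𝓘(ℝ, E × (E →L[ℝ] ℝ)) (cotangentModel E)
          (extChartAt (cotangentModel E) q).symm z w) = w := congrArg (fun L => L w) h2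
    rw [h3, (extChartAt (cotangentModel E) q).right_inv hz] at h1
    exact h1.symm
  have hder : ∀ (z v w : E × (E →L[ℝ] ℝ)), fderiv ℝ (fun z : E × (E →L[ℝ] ℝ) =>
      z.2.comp (ContinuousLinearMap.fst ℝ E (E →L[ℝ] ℝ))) z v w = v.2 w.1 := by
    intro z v w
    have h : HasFDerivAt (fun z : E × (E →L[ℝ] ℝ) =>
        z.2.comp (ContinuousLinearMap.fst ℝ E (E →L[ℝ] ℝ))) _ z :=
      hasFDerivAt_snd.clm_comp (hasFDerivAt_const (ContinuousLinearMap.fst ℝ E (E →L[ℝ] ℝ)) z)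
    rw [h.fderiv]
    simp
  have h' : ∀ η : E × (E →L[ℝ] ℝ) → (E × (E →L[ℝ] ℝ)) →L[ℝ] ℝ,
      η =ᶠ[𝓝 (extChartAt (cotangentModel E) q q)]
        (fun z => z.2.comp (ContinuousLinearMap.fst ℝ E (E →L[ℝ] ℝ))) →
      ∀ v w, fderiv ℝ η (extChartAt (cotangentModel E) q q) v w
        - fderiv ℝ η (extChartAt (cotangentModel E) q q) w v = stdSymplectic v w := by
    intro η hη v w
    rw [hη.fderiv_eq, hder, hder]
    rfl
  exact h' _ key _ _

/-- The symplectic form is standard in canonical coordinates. -/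
theorem symplectic_eq {p q : CotangentBundle E M}
    (hq : q ∈ (extChartAt (cotangentModel E) p).source)
    (v w : TangentSpace (cotangentModel E) q) :
    symplectic q v w = stdSymplectic (dchart (cotangentModel E) p q v)
      (dchart (cotangentModel E) p q w) := by
  -- By definition the form at `q` is computed in the chart at `q`; the change to the chart at `p`
  -- is handled by `stdSymplectic_map`.
  have hq' := mem_extChartAt_source (I := cotangentModel E) q
  rw [symplectic_eq_self, dchart_eq_fderiv_transition _ hq hq',
    dchart_eq_fderiv_transition _ hq hq', stdSymplectic_map]
  · exact (contDiffAt_transition _ hq hq').of_le (by norm_cast)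
  · have h1 := extChartAt_target_mem_nhds (I := cotangentModel E) q
    have h2 : ∀ᶠ z in 𝓝 (extChartAt (cotangentModel E) q q),
        (extChartAt (cotangentModel E) q).symm z ∈ (extChartAt (cotangentModel E) p).source :=
      (continuousAt_extChartAt_symm q).preimage_mem_nhds (by
        rw [extChartAt_to_inv]
        exact (isOpen_extChartAt_source p).mem_nhds hq)
    filter_upwards [h1, h2] with z hz1 hz2 u
    obtain ⟨y, hy, rfl⟩ : ∃ y ∈ (extChartAt (cotangentModel E) q).source,
        extChartAt (cotangentModel E) q y = z :=
      ⟨_, (extChartAt (cotangentModel E) q).map_target hz1,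
        (extChartAt (cotangentModel E) q).right_inv hz1⟩
    rw [(extChartAt (cotangentModel E) q).left_inv hy] at hz2 ⊢
    obtain ⟨v, rfl⟩ := (dchart_bijective (cotangentModel E) hy).2 u
    rw [← dchart_eq_fderiv_transition _ hz2 hy, cotangentChart_liouville hz2,
      cotangentChart_liouville hy]

theorem mem_vertical_iff {p q : CotangentBundle E M}
    (hq : q ∈ (extChartAt (cotangentModel E) p).source)
    (v : TangentSpace (cotangentModel E) q) :
    v ∈ vertical q ↔ (dchart (cotangentModel E) p q v).1 = 0 := by
  rw [dchart_fst hq]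
  have := (dchart_bijective 𝓘(ℝ, E) (mem_cotangentChart_source.1 hq)).1
  rw [map_eq_zero_iff _ this]
  rfl

theorem dproj_surjective (q : CotangentBundle E M) : Function.Surjective (dproj q) := by
  intro u
  have hq := mem_extChartAt_source (I := cotangentModel E) q
  obtain ⟨v, hv⟩ := (dchart_bijective (cotangentModel E) hq).2
    ((dchart 𝓘(ℝ, E) q.proj q.proj u, 0) : E × (E →L[ℝ] ℝ))
  refine ⟨v, (dchart_bijective 𝓘(ℝ, E) (mem_cotangentChart_source.1 hq)).1 ?_⟩
  rw [← dchart_fst hq, hv]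

end CotangentChart

/-! ## The sub-Riemannian Hamiltonian in coordinates -/

section Hamiltonian

variable {E M : Type*} [NormedAddCommGroup E] [NormedSpace ℝ E] [TopologicalSpace M]
  [ChartedSpace E M] [IsManifold 𝓘(ℝ, E) ∞ M]

namespace SubRiemannianStructure

variable (S : SubRiemannianStructure E M)

theorem eq_sum_of_orthonormal {y : M} {X : Fin S.rank → S.D y}
    (hX : ∀ i j, S.g y (X i) (X j) = if i = j then 1 else 0)
    (hspan : Submodule.span ℝ (Set.range fun i => (X i : TangentSpace 𝓘(ℝ, E) y)) = S.D y)
    (v : S.D y) : v = ∑ i, S.g y v (X i) • X i := by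
  have hv : (v : TangentSpace 𝓘(ℝ, E) y) ∈
      Submodule.span ℝ (Set.range fun i => (X i : TangentSpace 𝓘(ℝ, E) y)) := by
    rw [hspan]; exact v.2
  obtain ⟨a, ha⟩ := (Submodule.mem_span_range_iff_exists_fun ℝ).1 hv
  have hv' : v = ∑ i, a i • X i := by
    apply Subtype.ext
    simp [← ha]
  have ha' : ∀ j, S.g y v (X j) = a j := by
    intro j
    rw [hv']
    simp [hX]
  simp only [ha']
  exact hv'

/-- Parseval's identity: each frame is expanded in the other and the double sum is read in two ways.
-/
theorem sum_sq_eq_of_orthonormal {y : M} {X X' : Fin S.rank → S.D y}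
    (hX : ∀ i j, S.g y (X i) (X j) = if i = j then 1 else 0)
    (hspan : Submodule.span ℝ (Set.range fun i => (X i : TangentSpace 𝓘(ℝ, E) y)) = S.D y)
    (hX' : ∀ i j, S.g y (X' i) (X' j) = if i = j then 1 else 0)
    (hspan' : Submodule.span ℝ (Set.range fun i => (X' i : TangentSpace 𝓘(ℝ, E) y)) = S.D y)
    (ξ : TangentSpace 𝓘(ℝ, E) y →L[ℝ] ℝ) :
    ∑ i, ξ (X i : TangentSpace 𝓘(ℝ, E) y) ^ 2 = ∑ i, ξ (X' i : TangentSpace 𝓘(ℝ, E) y) ^ 2 := by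
  have expand : ∀ {X : Fin S.rank → S.D y}, (∀ i j, S.g y (X i) (X j) = if i = j then 1 else 0) →
      Submodule.span ℝ (Set.range fun i => (X i : TangentSpace 𝓘(ℝ, E) y)) = S.D y →
      ∀ v : S.D y, ξ (v : TangentSpace 𝓘(ℝ, E) y) =
        ∑ i, S.g y v (X i) * ξ (X i : TangentSpace 𝓘(ℝ, E) y) := by
    intro X hX hspan v
    conv_lhs => rw [S.eq_sum_of_orthonormal hX hspan v]
    simp
  calc ∑ i, ξ (X i : TangentSpace 𝓘(ℝ, E) y) ^ 2
      = ∑ i, ∑ j, ξ (X i : TangentSpace 𝓘(ℝ, E) y) *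
          (S.g y (X i) (X' j) * ξ (X' j : TangentSpace 𝓘(ℝ, E) y)) :=
        Finset.sum_congr rfl fun i _ => by
          rw [← Finset.mul_sum, ← expand hX' hspan' (X i), pow_two]
    _ = ∑ j, ∑ i, (S.g y (X' j) (X i) * ξ (X i : TangentSpace 𝓘(ℝ, E) y)) *
          ξ (X' j : TangentSpace 𝓘(ℝ, E) y) := by
        rw [Finset.sum_comm]
        refine Finset.sum_congr rfl fun j _ => Finset.sum_congr rfl fun i _ => ?_
        rw [S.g_symm]
        ring
    _ = _ := Finset.sum_congr rfl fun j _ => by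
          rw [← Finset.sum_mul, ← expand hX hspan (X' j), pow_two]

/-- The definition picks a frame separately for each base point, which hides the smoothness of the
Hamiltonian; here a single smooth local frame may be used. -/
theorem hamiltonian_eq {X : Fin S.rank → ∀ y : M, S.D y} {q : CotangentBundle E M}
    (hX : ∀ i j, S.g q.proj (X i q.proj) (X j q.proj) = if i = j then 1 else 0)
    (hspan : Submodule.span ℝ
      (Set.range fun i => (X i q.proj : TangentSpace 𝓘(ℝ, E) q.proj)) = S.D q.proj) :
    S.hamiltonian q = (1 / 2) * ∑ i, q.snd (X i q.proj : TangentSpace 𝓘(ℝ, E) q.proj) ^ 2 := by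
  obtain ⟨O, -, hO, -, h⟩ := (S.exists_frame q.proj).choose_spec
  rw [hamiltonian, S.sum_sq_eq_of_orthonormal (h q.proj hO).1 (h q.proj hO).2 hX hspan]

end SubRiemannianStructure

theorem dchart_hamiltonianField {h : CotangentBundle E M → ℝ} {p q : CotangentBundle E M}
    (hq : q ∈ (extChartAt (cotangentModel E) p).source) {u : E × (E →L[ℝ] ℝ)}
    (hu : ∀ w : TangentSpace (cotangentModel E) q,
      (mfderiv (cotangentModel E) 𝓘(ℝ, ℝ) h q w : ℝ)
        = stdSymplectic (dchart (cotangentModel E) p q w) u) :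
    dchart (cotangentModel E) p q (hamiltonianField h q) = u := by
  obtain ⟨v, rfl⟩ := (dchart_bijective (cotangentModel E) hq).2 u
  have hex : ∃ v : TangentSpace (cotangentModel E) q, ∀ w : TangentSpace (cotangentModel E) q,
      symplectic q w v = (mfderiv (cotangentModel E) 𝓘(ℝ, ℝ) h q w : ℝ) :=
    ⟨v, fun w => by rw [symplectic_eq hq, hu w]⟩
  have hspec := Classical.epsilon_spec hex
  refine stdSymplectic_nondegenerate fun u => ?_
  obtain ⟨w, rfl⟩ := (dchart_bijective (cotangentModel E) hq).2 u
  rw [← symplectic_eq hq, ← hu w]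
  exact hspec w

/-- In canonical coordinates the sub-Riemannian Hamiltonian field is the one of a sum of squares. -/
theorem SubRiemannianStructure.exists_coord_hamField (S : SubRiemannianStructure E M)
    (p : CotangentBundle E M) :
    ∃ (X : Fin S.rank → E → E) (B : Set (CotangentBundle E M)), IsOpen B ∧ p ∈ B ∧
      B ⊆ (extChartAt (cotangentModel E) p).source ∧
      ∀ q ∈ B, (∀ i, ContDiffAt ℝ ∞ (X i) (extChartAt (cotangentModel E) p q).1) ∧
        dchart (cotangentModel E) p q (S.hamField q)
          = flatHamField X (extChartAt (cotangentModel E) p q) := by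
  obtain ⟨X, O, hO, hpO, hsmooth, horth⟩ := S.exists_frame p.proj
  have hproj : Continuous (fun q : CotangentBundle E M => q.proj) :=
    (Bundle.contMDiff_proj (n := 1) (IB := 𝓘(ℝ, E)) (F := E →L[ℝ] ℝ)
      (fun x : M => TangentSpace 𝓘(ℝ, E) x →L[ℝ] ℝ)).continuous
  set χ := extChartAt (cotangentModel E) p with hχ
  set Xh : Fin S.rank → E → E := fun i => coordField 𝓘(ℝ, E) p.proj
    (fun y => (X i y : TangentSpace 𝓘(ℝ, E) y)) with hXh
  have hBopen : IsOpen (χ.source ∩ (fun q : CotangentBundle E M => q.proj) ⁻¹' O) :=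
    (isOpen_extChartAt_source p).inter (hO.preimage hproj)
  have hXs : ∀ q ∈ χ.source ∩ (fun q : CotangentBundle E M => q.proj) ⁻¹' O,
      ∀ i, ContDiffAt ℝ ∞ (Xh i) (χ q).1 := by
    rintro q ⟨hq, hqO⟩ i
    rw [cotangentChart_fst]
    exact contDiffAt_coordField 𝓘(ℝ, E) (mem_cotangentChart_source.1 hq) (hsmooth i)
      (hO.mem_nhds hqO)
  have hham : ∀ q ∈ χ.source ∩ (fun q : CotangentBundle E M => q.proj) ⁻¹' O,
      S.hamiltonian q = flatHam Xh (χ q) := by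
    rintro q ⟨hq, hqO⟩
    rw [S.hamiltonian_eq (horth q.proj hqO).1 (horth q.proj hqO).2, flatHam]
    congr 1
    refine Finset.sum_congr rfl fun i _ => ?_
    simp only [hXh]
    rw [cotangentChart_fst, coordField_apply _ (mem_cotangentChart_source.1 hq),
      cotangentChart_snd hq]
  refine ⟨Xh, _, hBopen, ⟨mem_extChartAt_source p, hpO⟩, Set.inter_subset_left, fun q hq =>
    ⟨hXs q hq, dchart_hamiltonianField hq.1 fun w => ?_⟩⟩
  have h1 : HasMFDerivAt (cotangentModel E) 𝓘(ℝ, E × (E →L[ℝ] ℝ)) χ q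
      (dchart (cotangentModel E) p q) :=
    (mdifferentiableAt_extChartAt (by simpa [hχ] using hq.1)).hasMFDerivAt
  have h2 := ((contDiffAt_flatHam (hXs q hq)).differentiableAt (by simp)).hasFDerivAt
  have h3 := (h2.hasMFDerivAt.comp q h1).congr_of_eventuallyEq
    (Filter.eventually_of_mem (hBopen.mem_nhds hq) hham)
  rw [h3.mfderiv]
  exact fderiv_flatHam (fun i => (hXs q hq i).differentiableAt (by simp)) _

end Hamiltonian

/-! ## Canonical frames and their horizontal spaces -/

section LieDerivShift

variable {V : Type*} [NormedAddCommGroup V] [NormedSpace ℝ V] {H : Type*} [TopologicalSpace H]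
  (I : ModelWithCorners ℝ V H) {P : Type*} [TopologicalSpace P] [ChartedSpace H P]

theorem HasLieDerivAlong.comp_add {Z : ∀ p : P, TangentSpace I p} {c : ℝ → P}
    {X : ∀ t, TangentSpace I (c t)} {t t₀ : ℝ} {W : TangentSpace I (c (t + t₀))}
    (h : HasLieDerivAlong I Z c X (t + t₀) W) :
    HasLieDerivAlong I Z (fun t => c (t + t₀)) (fun t => X (t + t₀)) t W := by
  obtain ⟨φ, δ, O, hφ, hder⟩ := h
  refine ⟨φ, δ, O, hφ, ?_⟩
  refine hder.congr_of_eventuallyEq (Filter.Eventually.of_forall fun ε => ?_)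
  exact congrArg (fun s => (mfderiv I 𝓘(ℝ, V)
    (fun q => extChartAt I (c (t + t₀)) (φ (-ε) q)) (c s) (X s) : V)) (add_right_comm t ε t₀)

theorem SmoothFieldAlongOn.comp_add [IsManifold I 1 P] {c : ℝ → P}
    {X : ∀ t, TangentSpace I (c t)} {s s' : Set ℝ} {t₀ : ℝ} (h : SmoothFieldAlongOn I c X s)
    (hs : ∀ t ∈ s', t + t₀ ∈ s) :
    SmoothFieldAlongOn I (fun t => c (t + t₀)) (fun t => X (t + t₀)) s' := by
  have h1 : ContMDiff 𝓘(ℝ, ℝ) 𝓘(ℝ, ℝ) ∞ (fun t : ℝ => t + t₀) :=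
    (contDiff_id.add contDiff_const).contMDiff
  exact ContMDiffOn.comp h h1.contMDiffOn hs

end LieDerivShift

section Frames

variable {E M : Type*} [NormedAddCommGroup E] [NormedSpace ℝ E] [TopologicalSpace M]
  [ChartedSpace E M] [IsManifold 𝓘(ℝ, E) ∞ M]

namespace SubRiemannianStructure

variable {S : SubRiemannianStructure E M}

omit [IsManifold 𝓘(ℝ, E) ∞ M] in
theorem mfderiv_comp_add (γ : ℝ → M) (s t₀ : ℝ) :
    mfderiv 𝓘(ℝ, ℝ) 𝓘(ℝ, E) (fun s => γ (s + t₀)) s (1 : ℝ)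
      = mfderiv 𝓘(ℝ, ℝ) 𝓘(ℝ, E) γ (s + t₀) (1 : ℝ) := by
  have hadd : ∀ s t₀ : ℝ, HasMFDerivAt 𝓘(ℝ, ℝ) 𝓘(ℝ, ℝ) (fun s : ℝ => s + t₀) s
      (ContinuousLinearMap.id ℝ ℝ) := fun s t₀ => ((hasFDerivAt_id s).add_const t₀).hasMFDerivAt
  by_cases h : MDifferentiableAt 𝓘(ℝ, ℝ) 𝓘(ℝ, E) γ (s + t₀)
  · have h1 := HasMFDerivAt.comp s (g := γ) (f := fun s : ℝ => s + t₀) h.hasMFDerivAt (hadd s t₀)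
    have h2 : HasMFDerivAt 𝓘(ℝ, ℝ) 𝓘(ℝ, E) (fun s => γ (s + t₀)) s _ := h1
    rw [h2.mfderiv]
    rfl
  -- Without differentiability, both derivatives have the default value zero.
  · have h' : ¬ MDifferentiableAt 𝓘(ℝ, ℝ) 𝓘(ℝ, E) (fun s => γ (s + t₀)) s := by
      intro h'
      apply h
      have h'' : MDifferentiableAt 𝓘(ℝ, ℝ) 𝓘(ℝ, E) (fun s => γ (s + t₀)) (s + t₀ + -t₀) := by
        rw [add_neg_cancel_right]; exact h'
      have h1 := HasMFDerivAt.comp (s + t₀) (f := fun s : ℝ => s + -t₀) h''.hasMFDerivAt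
        (hadd (s + t₀) (-t₀))
      have h2 : (fun s => γ (s + t₀)) ∘ (fun s : ℝ => s + -t₀) = γ := by
        funext s; simp
      rw [h2] at h1
      exact h1.mdifferentiableAt
    rw [mfderiv_zero_of_not_mdifferentiableAt h, mfderiv_zero_of_not_mdifferentiableAt h']
    rfl

theorem flag_comp_add (γ : ℝ → M) (t t₀ : ℝ) (i : ℕ) :
    S.flag (fun t => γ (t + t₀)) t i = S.flag γ (t + t₀) i := by
  have h : ∀ T : ∀ x : M, TangentSpace 𝓘(ℝ, E) x,
      (∀ᶠ s in 𝓝 t, T (γ (s + t₀)) = mfderiv 𝓘(ℝ, ℝ) 𝓘(ℝ, E) (fun s => γ (s + t₀)) s (1 : ℝ)) ↔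
      (∀ᶠ s in 𝓝 (t + t₀), T (γ s) = mfderiv 𝓘(ℝ, ℝ) 𝓘(ℝ, E) γ s (1 : ℝ)) := by
    intro T
    rw [← map_add_right_nhds t₀ t, Filter.eventually_map]
    simp only [mfderiv_comp_add]
  unfold flag
  simp only [h]

theorem flag_mono (γ : ℝ → M) (t : ℝ) {i j : ℕ} (hij : i ≤ j) : S.flag γ t i ≤ S.flag γ t j := by
  refine Submodule.span_mono ?_
  rintro v ⟨T, X, k, h1, h2, h3, h4, h5, h6, h7⟩
  exact ⟨T, X, k, h1, h2, h3, h4, h5, h6.trans_le hij, h7⟩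

theorem flag_zero (γ : ℝ → M) (t : ℝ) : S.flag γ t 0 = ⊥ := by
  rw [flag, Submodule.span_eq_bot]
  rintro v ⟨T, X, k, h1, h2, h3, h4, h5, h6, h7⟩
  exact absurd h6 (Nat.not_lt_zero k)

theorem mem_Ioo_of_shift {ε t t₀ : ℝ} (h : t ∈ Set.Ioo (-(ε - |t₀|)) (ε - |t₀|)) :
    t + t₀ ∈ Set.Ioo (-ε) ε := by
  have h1 := neg_abs_le t₀
  have h2 := le_abs_self t₀
  constructor <;> linarith [h.1, h.2]

theorem IsExtremal.comp_add {c : ℝ → CotangentBundle E M} {ε t₀ : ℝ} (h : S.IsExtremal c ε)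
    (ht₀ : t₀ ∈ Set.Ioo (-ε) ε) : S.IsExtremal (fun t => c (t + t₀)) (ε - |t₀|) :=
  ⟨sub_pos.2 (abs_lt.2 ht₀), (h.2.comp_add t₀).mono fun _ ht => mem_Ioo_of_shift ht⟩

theorem IsAmpleEquiregular.comp_add {γ : ℝ → M} {ε t₀ : ℝ} (h : S.IsAmpleEquiregular γ ε)
    (ht₀ : t₀ ∈ Set.Ioo (-ε) ε) : S.IsAmpleEquiregular (fun t => γ (t + t₀)) (ε - |t₀|) where
  ample t ht := by
    obtain ⟨m, hm, h'⟩ := h.ample (t + t₀) (mem_Ioo_of_shift ht)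
    exact ⟨m, hm, by rw [flag_comp_add]; exact h'⟩
  equiregular t ht i := by
    rw [flag_comp_add, flag_comp_add]
    have h0 : (0 : ℝ) + t₀ ∈ Set.Ioo (-ε) ε := by rwa [zero_add]
    exact (h.equiregular _ (mem_Ioo_of_shift ht) i).trans (h.equiregular _ h0 i).symm

theorem finrank_flag_comp_add {γ : ℝ → M} {ε t₀ : ℝ} (h : S.IsAmpleEquiregular γ ε)
    (ht₀ : t₀ ∈ Set.Ioo (-ε) ε) (i : ℕ) :
    Module.finrank ℝ (S.flag (fun t => γ (t + t₀)) 0 i) = Module.finrank ℝ (S.flag γ 0 i) := by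
  rw [flag_comp_add]
  exact h.equiregular _ (by rwa [zero_add]) i

/-- The time shift of a canonical frame. -/
def CanonicalFrame.shift {c : ℝ → CotangentBundle E M} {ε : ℝ} (fr : S.CanonicalFrame c ε) {t₀ : ℝ}
    (ht₀ : t₀ ∈ Set.Ioo (-ε) ε) : S.CanonicalFrame (fun t => c (t + t₀)) (ε - |t₀|) where
  extremal := fr.extremal.comp_add ht₀
  regular := fr.regular.comp_add ht₀
  Y := fr.Y
  -- The same Young diagram serves at the new initial time by equiregularity.
  colLen_eq i := by
    have h1 := finrank_flag_comp_add fr.regular ht₀ i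
    have h2 := finrank_flag_comp_add fr.regular ht₀ (i + 1)
    have h3 := fr.colLen_eq i
    exact (congrArg (· + fr.Y.colLen i) h1).trans (h3.trans h2.symm)
  e b t := fr.e b (t + t₀)
  f b t := fr.f b (t + t₀)
  R t := fr.R (t + t₀)
  smooth_e b := (fr.smooth_e b).comp_add _ fun _ ht => mem_Ioo_of_shift ht
  smooth_f b := (fr.smooth_f b).comp_add _ fun _ ht => mem_Ioo_of_shift ht
  smooth_R b b' := (fr.smooth_R b b').comp (contDiff_id.add contDiff_const).contDiffOn
    fun _ ht => mem_Ioo_of_shift ht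
  vertical_e t ht := fr.vertical_e _ (mem_Ioo_of_shift ht)
  darboux_ee t ht := fr.darboux_ee _ (mem_Ioo_of_shift ht)
  darboux_ff t ht := fr.darboux_ff _ (mem_Ioo_of_shift ht)
  darboux_ef t ht := fr.darboux_ef _ (mem_Ioo_of_shift ht)
  deriv_e_succ t ht a i h h' := (fr.deriv_e_succ _ (mem_Ioo_of_shift ht) a i h h').comp_add
  deriv_e_zero t ht a h := (fr.deriv_e_zero _ (mem_Ioo_of_shift ht) a h).comp_add
  deriv_f t ht a i h h' := (fr.deriv_f _ (mem_Ioo_of_shift ht) a i h h').comp_add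
  deriv_f_last t ht a i h h' := (fr.deriv_f_last _ (mem_Ioo_of_shift ht) a i h h').comp_add
  normal t ht := fr.normal _ (mem_Ioo_of_shift ht)

/-! ### Dimension counts, and the span of a canonical frame -/

section Dimension

variable [FiniteDimensional ℝ E]

instance (x : M) : FiniteDimensional ℝ (TangentSpace 𝓘(ℝ, E) x) :=
  inferInstanceAs (FiniteDimensional ℝ E)

instance : FiniteDimensional ℝ (E →L[ℝ] ℝ) :=
  LinearMap.toContinuousLinearMap.finiteDimensional

instance (p : CotangentBundle E M) : FiniteDimensional ℝ (TangentSpace (cotangentModel E) p) :=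
  inferInstanceAs (FiniteDimensional ℝ (E × (E →L[ℝ] ℝ)))

omit [FiniteDimensional ℝ E] in
-- The column lengths are the increments of the flag; their sum telescopes to the dimension of the
-- whole tangent space, by ampleness.
theorem IsAmpleEquiregular.card_cells {γ : ℝ → M} {ε : ℝ} (hγ : S.IsAmpleEquiregular γ ε)
    (hε : 0 < ε) {Y : YoungDiagram} (hY : ∀ i, Module.finrank ℝ (S.flag γ 0 i) + Y.colLen i =
      Module.finrank ℝ (S.flag γ 0 (i + 1))) : Y.cells.card = Module.finrank ℝ E := by
  obtain ⟨m, -, hm⟩ := hγ.ample 0 ⟨neg_lt_zero.2 hε, hε⟩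
  set F := fun i => Module.finrank ℝ (S.flag γ 0 i) with hF
  have hfull : ∀ K : Submodule ℝ (TangentSpace 𝓘(ℝ, E) (γ 0)), K = ⊤ →
      Module.finrank ℝ K = Module.finrank ℝ E := by
    rintro _ rfl
    exact finrank_top ℝ _
  have hnull : ∀ K : Submodule ℝ (TangentSpace 𝓘(ℝ, E) (γ 0)), K = ⊥ →
      Module.finrank ℝ K = 0 := by
    rintro _ rfl
    exact finrank_bot ℝ _
  have htop : ∀ i, m ≤ i → F i = Module.finrank ℝ E := by
    intro i hi
    have h1 : S.flag γ 0 i = ⊤ :=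
      top_le_iff.1 (hm ▸ S.flag_mono γ 0 hi)
    exact hfull _ h1
  have hsum : ∀ i, ∑ j ∈ Finset.range i, Y.colLen j = F i := by
    intro i
    induction i with
    | zero => exact (hnull _ (flag_zero γ 0)).symm
    | succ i ih => rw [Finset.sum_range_succ, ih]; exact hY i
  have hcol : ∀ i, m ≤ i → Y.colLen i = 0 := by
    intro i hi
    have := hY i
    have h1 := htop i hi
    have h2 := htop (i + 1) (by omega)
    simp only [hF] at h1 h2
    omega
  rw [Finset.card_eq_sum_card_fiberwise (f := Prod.snd) (t := Finset.range m)]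
  · rw [← htop m le_rfl, ← hsum m]
    exact Finset.sum_congr rfl fun i _ => Y.colLen_eq_card.symm
  · rintro ⟨a, i⟩ hb
    by_contra hi
    have h1 := YoungDiagram.mem_iff_lt_colLen.1 ((YoungDiagram.mem_cells _).1 hb)
    rw [hcol i (by simpa using hi)] at h1
    exact absurd h1 (Nat.not_lt_zero _)

omit [FiniteDimensional ℝ E] in
/-- The number of boxes of the Young diagram of a canonical frame is the dimension of `M`. -/
theorem CanonicalFrame.card_cells {c : ℝ → CotangentBundle E M} {ε : ℝ}
    (fr : S.CanonicalFrame c ε) : fr.Y.cells.card = Module.finrank ℝ E :=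
  fr.regular.card_cells fr.extremal.1 fr.colLen_eq

omit [FiniteDimensional ℝ E] in
theorem CanonicalFrame.linearIndependent_f {c : ℝ → CotangentBundle E M} {ε : ℝ}
    (fr : S.CanonicalFrame c ε) : LinearIndependent ℝ (fun b => fr.f b 0) := by
  have h0 : (0 : ℝ) ∈ Set.Ioo (-ε) ε := ⟨neg_lt_zero.2 fr.extremal.1, fr.extremal.1⟩
  rw [Fintype.linearIndependent_iff]
  intro a ha b
  have h1 : stdSymplectic (dchart (cotangentModel E) (c 0) (c 0) (fr.e b 0))
      (∑ b', a b' • dchart (cotangentModel E) (c 0) (c 0) (fr.f b' 0)) = 0 := by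
    have h2 := congrArg (dchart (cotangentModel E) (c 0) (c 0)) ha
    simp only [map_sum, map_smul, map_zero] at h2
    rw [h2]
    simp [stdSymplectic]
  simpa only [stdSymplectic_sum_right, stdSymplectic_smul_right, ← symplectic_eq_self,
    fr.darboux_ef 0 h0, mul_ite, mul_one, mul_zero, Finset.sum_ite_eq, Finset.mem_univ,
    if_true] using h1

theorem finrank_of_isCompl_vertical {p : CotangentBundle E M}
    {K : Submodule ℝ (TangentSpace (cotangentModel E) p)} (hK : IsCompl K (vertical p)) :
    Module.finrank ℝ K = Module.finrank ℝ E := by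
  have h1 := Submodule.finrank_add_eq_of_isCompl hK
  have h2 := LinearMap.finrank_range_add_finrank_ker (dproj p).toLinearMap
  have h3 : LinearMap.range (dproj p).toLinearMap = ⊤ :=
    LinearMap.range_eq_top.2 (dproj_surjective p)
  rw [h3, finrank_top] at h2
  have h4 : Module.finrank ℝ (TangentSpace 𝓘(ℝ, E) p.proj) = Module.finrank ℝ E := rfl
  have h5 : Module.finrank ℝ (vertical p) = Module.finrank ℝ (dproj p).toLinearMap.ker := rfl
  omega

/-- If the canonical horizontal space is complementary to the vertical one, it is spanned by any
canonical frame. -/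
theorem CanonicalFrame.span_f_eq {c : ℝ → CotangentBundle E M} {ε : ℝ}
    (fr : S.CanonicalFrame c ε) (h : IsCompl (S.canonicalHor (c 0)) (vertical (c 0))) :
    Submodule.span ℝ (Set.range fun b => fr.f b 0) = S.canonicalHor (c 0) := by
  -- The canonical space is generated by all frames at once, so one inclusion is clear.
  -- Complementarity gives it dimension `n`, which is also the number of independent vectors of the
  -- given frame.
  refine Submodule.eq_of_le_of_finrank_eq ?_ ?_
  · refine Submodule.span_mono ?_
    rintro _ ⟨b, rfl⟩
    exact ⟨c, ε, fr, b, rfl⟩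
  · rw [finrank_of_isCompl_vertical h, finrank_span_eq_card fr.linearIndependent_f, ← fr.card_cells,
      Fintype.card_coe]

/-- A time shift makes `t` the initial time, so one frame describes the canonical horizontal space
at all nearby points of the extremal. -/
theorem CanonicalFrame.span_f_eq_of_mem {c : ℝ → CotangentBundle E M} {ε : ℝ}
    (fr : S.CanonicalFrame c ε) {t : ℝ} (ht : t ∈ Set.Ioo (-ε) ε)
    (h : IsCompl (S.canonicalHor (c t)) (vertical (c t))) :
    Submodule.span ℝ (Set.range fun b => fr.f b t) = S.canonicalHor (c t) := by
  have h1 := (fr.shift ht).span_f_eq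
  have key : ∀ s, s = t → (IsCompl (S.canonicalHor (c s)) (vertical (c s)) →
      Submodule.span ℝ (Set.range fun b => fr.f b s) = S.canonicalHor (c s)) →
      Submodule.span ℝ (Set.range fun b => fr.f b t) = S.canonicalHor (c t) := by
    rintro s rfl h'
    exact h' h
  exact key (0 + t) (zero_add t) h1

/-- A canonical frame exists wherever the canonical horizontal space is complementary to
the vertical one. -/
theorem exists_canonicalFrame {p : CotangentBundle E M} (hp : p ∈ S.ampleEquiregularCovectors)
    (h : IsCompl (S.canonicalHor p) (vertical p)) :
    ∃ (c : ℝ → CotangentBundle E M) (ε : ℝ) (_ : S.CanonicalFrame c ε), c 0 = p := by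
  by_contra hne
  -- Without frames the spanning set is empty. Being complementary to the vertical space, the zero
  -- space forces `dim M = 0`, and then the empty frame is a canonical frame.
  have hbot : S.canonicalHor p = ⊥ := by
    rw [canonicalHor, Submodule.span_eq_bot]
    rintro v ⟨c, ε, fr, b, hb⟩
    exact absurd ⟨c, ε, fr, congrArg Bundle.TotalSpace.proj hb⟩ hne
  have hdim : Module.finrank ℝ E = 0 := by
    rw [← finrank_of_isCompl_vertical h, hbot, finrank_bot]
  have hsub : Subsingleton E := Module.finrank_zero_iff.1 hdim
  have hflag : ∀ (γ : ℝ → M) (i : ℕ), Module.finrank ℝ (S.flag γ 0 i) = 0 := fun γ i =>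
    Nat.le_zero.1 ((Submodule.finrank_le _).trans hdim.le)
  obtain ⟨c, ε, hext, hc, hreg⟩ := hp
  refine hne ⟨c, ε, ?_, hc⟩
  have : IsEmpty (⊥ : YoungDiagram).cells := by
    rw [YoungDiagram.cells_bot]; infer_instance
  exact
    { extremal := hext
      regular := hreg
      Y := ⊥
      colLen_eq := fun i => by
        have h0 : (⊥ : YoungDiagram).colLen i = 0 := by
          rw [YoungDiagram.colLen_eq_card]
          simp [YoungDiagram.col]
        rw [h0]
        exact (hflag _ i).trans (hflag _ (i + 1)).symm
      e := fun b => isEmptyElim b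
      f := fun b => isEmptyElim b
      R := fun _ b => isEmptyElim b
      smooth_e := fun b => isEmptyElim b
      smooth_f := fun b => isEmptyElim b
      smooth_R := fun b => isEmptyElim b
      vertical_e := fun _ _ b => isEmptyElim b
      darboux_ee := fun _ _ b => isEmptyElim b
      darboux_ff := fun _ _ b => isEmptyElim b
      darboux_ef := fun _ _ b => isEmptyElim b
      deriv_e_succ := fun _ _ a i h => isEmptyElim (⟨_, h⟩ : (⊥ : YoungDiagram).cells)
      deriv_e_zero := fun _ _ a h => isEmptyElim (⟨_, h⟩ : (⊥ : YoungDiagram).cells)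
      deriv_f := fun _ _ a i h => isEmptyElim (⟨_, h⟩ : (⊥ : YoungDiagram).cells)
      deriv_f_last := fun _ _ a i h => isEmptyElim (⟨_, h⟩ : (⊥ : YoungDiagram).cells)
      normal := fun _ _ =>
        { symm := fun b => isEmptyElim b
          skew := fun a b i h => isEmptyElim (⟨_, h⟩ : (⊥ : YoungDiagram).cells)
          vanish_eq := fun b => isEmptyElim b
          vanish_gt := fun b => isEmptyElim b } }

end Dimension

end SubRiemannianStructure

end Frames

/-! ## Ehresmann connections in coordinates -/

section Connection

variable {E M : Type*} [NormedAddCommGroup E] [NormedSpace ℝ E] [TopologicalSpace M]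
  [ChartedSpace E M] [IsManifold 𝓘(ℝ, E) ∞ M]

theorem exists_mem_dproj_eq {q : CotangentBundle E M}
    {K : Submodule ℝ (TangentSpace (cotangentModel E) q)} (hK : IsCompl K (vertical q))
    (u : TangentSpace 𝓘(ℝ, E) q.proj) : ∃ v ∈ K, dproj q v = u := by
  obtain ⟨v, rfl⟩ := dproj_surjective q u
  obtain ⟨k, hk, w, hw, rfl⟩ := Submodule.mem_sup.1 (hK.sup_eq_top ▸ Submodule.mem_top (x := v))
  refine ⟨k, hk, ?_⟩
  have : dproj q w = 0 := hw
  rw [map_add, this, add_zero]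

theorem contDiffAt_smulRight {V F G : Type*} [NormedAddCommGroup V] [NormedSpace ℝ V]
    [NormedAddCommGroup F] [NormedSpace ℝ F] [NormedAddCommGroup G] [NormedSpace ℝ G]
    (l : G →L[ℝ] ℝ) {f : V → F} {z : V} (hf : ContDiffAt ℝ ∞ f z) :
    ContDiffAt ℝ ∞ (fun z => l.smulRight (f z)) z :=
  (ContinuousLinearMap.smulRightL ℝ G F l).contDiff.contDiffAt.comp z hf

/-- `A` and `C` collect the base and fibre components of a smooth local frame of `hor`.
Complementarity makes `A` invertible, so `hor` is the graph of `C ∘ A⁻¹`, which is smooth because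
inversion is. -/
theorem IsEhresmannConnectionOn.exists_coord [FiniteDimensional ℝ E]
    {hor : ∀ p : CotangentBundle E M, Submodule ℝ (TangentSpace (cotangentModel E) p)}
    {U : Set (CotangentBundle E M)} (h : IsEhresmannConnectionOn hor U) (hU : IsOpen U)
    {p : CotangentBundle E M} (hp : p ∈ U) :
    ∃ (Γ : E × (E →L[ℝ] ℝ) → E →L[ℝ] E →L[ℝ] ℝ) (B : Set (CotangentBundle E M)), IsOpen B ∧ p ∈ B ∧
      B ⊆ (extChartAt (cotangentModel E) p).source ∧ B ⊆ U ∧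
      ∀ q ∈ B, ContDiffAt ℝ ∞ Γ (extChartAt (cotangentModel E) p q) ∧ ∀ v, v ∈ hor q ↔
        (dchart (cotangentModel E) p q v).2 =
          Γ (extChartAt (cotangentModel E) p q) (dchart (cotangentModel E) p q v).1 := by
  obtain ⟨O, k, Z, hO, hpO, hZ, hspan⟩ := h.smooth p hp
  set χ := extChartAt (cotangentModel E) p
  set Zh : Fin k → E × (E →L[ℝ] ℝ) → E × (E →L[ℝ] ℝ) := fun i =>
    coordField (cotangentModel E) p (Z i) with hZh
  set A : E × (E →L[ℝ] ℝ) → (Fin k → ℝ) →L[ℝ] E := fun z =>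
    ∑ i, (ContinuousLinearMap.proj (R := ℝ) (φ := fun _ : Fin k => ℝ) i).smulRight (Zh i z).1 with hA
  set C : E × (E →L[ℝ] ℝ) → (Fin k → ℝ) →L[ℝ] (E →L[ℝ] ℝ) := fun z =>
    ∑ i, (ContinuousLinearMap.proj (R := ℝ) (φ := fun _ : Fin k => ℝ) i).smulRight (Zh i z).2 with hC
  refine ⟨fun z => (C z).comp (A z).inverse, O ∩ U ∩ χ.source,
    (hO.inter hU).inter (isOpen_extChartAt_source p), ⟨⟨hpO, hp⟩, mem_extChartAt_source p⟩,
    Set.inter_subset_right, fun q hq => hq.1.2, ?_⟩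
  rintro q ⟨⟨hqO, hqU⟩, hq⟩
  have hAa : ∀ a : Fin k → ℝ,
      A (χ q) a = (dchart (cotangentModel E) p q (∑ i, a i • Z i q)).1 := by
    intro a
    simp only [hA, hZh, χ, map_sum, map_smul, Prod.fst_sum, Prod.smul_fst, coordField_apply _ hq,
      sum_apply, ContinuousLinearMap.smulRight_apply,
      ContinuousLinearMap.proj_apply]
  have hCa : ∀ a : Fin k → ℝ,
      C (χ q) a = (dchart (cotangentModel E) p q (∑ i, a i • Z i q)).2 := by
    intro a
    simp only [hC, hZh, χ, map_sum, map_smul, Prod.snd_sum, Prod.smul_snd, coordField_apply _ hq,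
      sum_apply, ContinuousLinearMap.smulRight_apply,
      ContinuousLinearMap.proj_apply]
  have hmem : ∀ a : Fin k → ℝ, ∑ i, a i • Z i q ∈ hor q := by
    intro a
    rw [← (hspan q ⟨hqO, hqU⟩).2]
    exact (Submodule.mem_span_range_iff_exists_fun ℝ).2 ⟨a, rfl⟩
  have hinj : Function.Injective (A (χ q)) := by
    refine (injective_iff_map_eq_zero _).2 fun a ha => ?_
    rw [hAa, ← mem_vertical_iff hq] at ha
    have h0 := Submodule.disjoint_def.1 (h.isCompl q hqU).disjoint _ (hmem a) ha
    exact funext (Fintype.linearIndependent_iff.1 (hspan q ⟨hqO, hqU⟩).1 a h0)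
  have hsurj : Function.Surjective (A (χ q)) := by
    intro u
    obtain ⟨w, hw⟩ := (dchart_bijective 𝓘(ℝ, E) (mem_cotangentChart_source.1 hq)).2 u
    obtain ⟨v, hv, hvw⟩ := exists_mem_dproj_eq (h.isCompl q hqU) w
    rw [← (hspan q ⟨hqO, hqU⟩).2] at hv
    obtain ⟨a, ha⟩ := (Submodule.mem_span_range_iff_exists_fun ℝ).1 hv
    exact ⟨a, by rw [hAa, ha, dchart_fst hq, hvw, hw]⟩
  obtain ⟨A', hA'⟩ : ∃ A' : (Fin k → ℝ) ≃L[ℝ] E, (A' : (Fin k → ℝ) →L[ℝ] E) = A (χ q) :=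
    ⟨(LinearEquiv.ofBijective (A (χ q)).toLinearMap ⟨hinj, hsurj⟩).toContinuousLinearEquiv, by
      ext1 a; rfl⟩
  constructor
  · have hZs : ∀ i, ContDiffAt ℝ ∞ (Zh i) (χ q) := fun i =>
      contDiffAt_coordField _ hq (hZ i) (hO.mem_nhds hqO)
    have hAs : ContDiffAt ℝ ∞ A (χ q) := ContDiffAt.sum fun i _ =>
      contDiffAt_smulRight _ (hZs i).fst
    have hCs : ContDiffAt ℝ ∞ C (χ q) := ContDiffAt.sum fun i _ =>
      contDiffAt_smulRight _ (hZs i).snd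
    refine hCs.clm_comp (ContDiffAt.comp (χ q) (g := ContinuousLinearMap.inverse) ?_ hAs)
    rw [← hA']
    exact contDiffAt_map_inverse A'
  · intro v
    change _ ↔ _ = C (χ q) ((A (χ q)).inverse (dchart (cotangentModel E) p q v).1)
    rw [← hA', ContinuousLinearMap.inverse_equiv]
    set a := A'.symm (dchart (cotangentModel E) p q v).1
    have ha : A (χ q) a = (dchart (cotangentModel E) p q v).1 := by
      rw [← hA']; exact A'.apply_symm_apply _
    change _ ↔ _ = C (χ q) a
    rw [hCa]
    rw [hAa] at ha
    constructor
    · intro hv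
      rw [← (hspan q ⟨hqO, hqU⟩).2] at hv
      obtain ⟨a', rfl⟩ := (Submodule.mem_span_range_iff_exists_fun ℝ).1 hv
      rw [← hAa, ← hAa] at ha
      rw [hinj ha]
    · intro hv
      rw [← (dchart_bijective _ hq).1 (Prod.ext ha hv.symm)]
      exact hmem a

end Connection

/-! ## Charts adapted to a sub-Riemannian structure and to an Ehresmann connection -/

section Adapted

variable {E M : Type*} [NormedAddCommGroup E] [NormedSpace ℝ E] [TopologicalSpace M]
  [ChartedSpace E M] [IsManifold 𝓘(ℝ, E) ∞ M]

/-- In the chart at `p`, over the open set `B`, the sub-Riemannian Hamiltonian field is the one of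
the sum of squares given by `X`, and the distribution `hor` is the graph of `Γ`. -/
structure IsAdaptedChart (S : SubRiemannianStructure E M)
    (hor : ∀ p : CotangentBundle E M, Submodule ℝ (TangentSpace (cotangentModel E) p))
    (p : CotangentBundle E M) (X : Fin S.rank → E → E)
    (Γ : E × (E →L[ℝ] ℝ) → E →L[ℝ] E →L[ℝ] ℝ) (B : Set (CotangentBundle E M)) : Prop where
  isOpen : IsOpen B
  mem : p ∈ B
  subset_source : B ⊆ (extChartAt (cotangentModel E) p).source
  smooth_X : ∀ q ∈ B, ∀ i, ContDiffAt ℝ ∞ (X i) (extChartAt (cotangentModel E) p q).1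
  dchart_hamField : ∀ q ∈ B, dchart (cotangentModel E) p q (S.hamField q) =
    flatHamField X (extChartAt (cotangentModel E) p q)
  smooth_Γ : ∀ q ∈ B, ContDiffAt ℝ ∞ Γ (extChartAt (cotangentModel E) p q)
  mem_hor_iff : ∀ q ∈ B, ∀ v, v ∈ hor q ↔ (dchart (cotangentModel E) p q v).2 =
    Γ (extChartAt (cotangentModel E) p q) (dchart (cotangentModel E) p q v).1

/-- The coordinate expression of the horizontal lift of a vector field. -/
def flatLift (Γ : E × (E →L[ℝ] ℝ) → E →L[ℝ] E →L[ℝ] ℝ) (X : E → E) (z : E × (E →L[ℝ] ℝ)) :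
    E × (E →L[ℝ] ℝ) := (X z.1, Γ z (X z.1))

theorem contDiffAt_flatLift {Γ : E × (E →L[ℝ] ℝ) → E →L[ℝ] E →L[ℝ] ℝ} {X : E → E}
    {z : E × (E →L[ℝ] ℝ)} (hΓ : ContDiffAt ℝ ∞ Γ z) (hX : ContDiffAt ℝ ∞ X z.1) :
    ContDiffAt ℝ ∞ (flatLift Γ X) z :=
  (hX.comp z contDiffAt_fst).prodMk (hΓ.clm_apply (hX.comp z contDiffAt_fst))

theorem exists_isAdaptedChart [FiniteDimensional ℝ E] (S : SubRiemannianStructure E M)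
    {hor : ∀ p : CotangentBundle E M, Submodule ℝ (TangentSpace (cotangentModel E) p)}
    {U : Set (CotangentBundle E M)} (h : IsEhresmannConnectionOn hor U) (hU : IsOpen U)
    {p : CotangentBundle E M} (hp : p ∈ U) : ∃ X Γ B, IsAdaptedChart S hor p X Γ B ∧ B ⊆ U := by
  obtain ⟨X, B₁, ho₁, hp₁, hs₁, h₁⟩ := S.exists_coord_hamField p
  obtain ⟨Γ, B₂, ho₂, hp₂, hs₂, hU₂, h₂⟩ := h.exists_coord hU hp
  exact ⟨X, Γ, B₁ ∩ B₂, ⟨ho₁.inter ho₂, ⟨hp₁, hp₂⟩, fun q hq => hs₁ hq.1, fun q hq => (h₁ q hq.1).1,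
    fun q hq => (h₁ q hq.1).2, fun q hq => (h₂ q hq.2).1, fun q hq => (h₂ q hq.2).2⟩,
    fun q hq => hU₂ hq.2⟩

namespace IsAdaptedChart

variable {S : SubRiemannianStructure E M}
    {hor : ∀ p : CotangentBundle E M, Submodule ℝ (TangentSpace (cotangentModel E) p)}
    {p : CotangentBundle E M} {X : Fin S.rank → E → E}
    {Γ : E × (E →L[ℝ] ℝ) → E →L[ℝ] E →L[ℝ] ℝ} {B : Set (CotangentBundle E M)}

theorem dchart_horizontalLift (hB : IsAdaptedChart S hor p X Γ B) {q : CotangentBundle E M}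
    (hq : q ∈ B) (Y : ∀ x : M, TangentSpace 𝓘(ℝ, E) x) :
    dchart (cotangentModel E) p q (horizontalLift hor Y q) =
      flatLift Γ (coordField 𝓘(ℝ, E) p.proj Y) (extChartAt (cotangentModel E) p q) := by
  have hqs := hB.subset_source hq
  have hqs' := mem_cotangentChart_source.1 hqs
  have hex : ∃ v, v ∈ hor q ∧ dproj q v = Y q.proj := by
    obtain ⟨v, hv⟩ := (dchart_bijective (cotangentModel E) hqs).2
      (dchart 𝓘(ℝ, E) p.proj q.proj (Y q.proj),
        Γ (extChartAt (cotangentModel E) p q) (dchart 𝓘(ℝ, E) p.proj q.proj (Y q.proj)))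
    refine ⟨v, (hB.mem_hor_iff q hq v).2 (by rw [hv]), ?_⟩
    apply (dchart_bijective 𝓘(ℝ, E) hqs').1
    rw [← dchart_fst hqs, hv]
  have hspec : horizontalLift hor Y q ∈ hor q ∧ dproj q (horizontalLift hor Y q) = Y q.proj :=
    Classical.epsilon_spec hex
  have h1 : (dchart (cotangentModel E) p q (horizontalLift hor Y q)).1 =
      coordField 𝓘(ℝ, E) p.proj Y (extChartAt (cotangentModel E) p q).1 := by
    rw [dchart_fst hqs, hspec.2, cotangentChart_fst, coordField_apply _ hqs']
  refine Prod.ext h1 ?_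
  rw [(hB.mem_hor_iff q hq _).1 hspec.1, h1]
  rfl

theorem eventually_nhds_chart (hB : IsAdaptedChart S hor p X Γ B) {q : CotangentBundle E M}
    (hq : q ∈ B) {Q : E × (E →L[ℝ] ℝ) → Prop}
    (hQ : ∀ q ∈ B, Q (extChartAt (cotangentModel E) p q)) :
    ∀ᶠ z in 𝓝 (extChartAt (cotangentModel E) p q), Q z := by
  have hqs := hB.subset_source hq
  have h1 := extChartAt_target_mem_nhds' ((extChartAt (cotangentModel E) p).map_source hqs)
  have h2 : ∀ᶠ z in 𝓝 (extChartAt (cotangentModel E) p q),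
      (extChartAt (cotangentModel E) p).symm z ∈ B :=
    (continuousAt_extChartAt_symm' hqs).preimage_mem_nhds (by
      rw [(extChartAt (cotangentModel E) p).left_inv hqs]
      exact hB.isOpen.mem_nhds hq)
  filter_upwards [h1, h2] with z hz1 hz2
  have := hQ _ hz2
  rwa [(extChartAt (cotangentModel E) p).right_inv hz1] at this

theorem coordField_horizontalLift (hB : IsAdaptedChart S hor p X Γ B) {q : CotangentBundle E M}
    (hq : q ∈ B) (Y : ∀ x : M, TangentSpace 𝓘(ℝ, E) x) :
    coordField (cotangentModel E) p (horizontalLift hor Y)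
      =ᶠ[𝓝 (extChartAt (cotangentModel E) p q)]
      flatLift Γ (coordField 𝓘(ℝ, E) p.proj Y) :=
  hB.eventually_nhds_chart hq (Q := fun z => coordField (cotangentModel E) p
    (horizontalLift hor Y) z = flatLift Γ (coordField 𝓘(ℝ, E) p.proj Y) z) fun q hq => by
    rw [coordField_apply _ (hB.subset_source hq), hB.dchart_horizontalLift hq]

theorem coordField_hamField (hB : IsAdaptedChart S hor p X Γ B) {q : CotangentBundle E M}
    (hq : q ∈ B) :
    coordField (cotangentModel E) p S.hamField =ᶠ[𝓝 (extChartAt (cotangentModel E) p q)]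
      flatHamField X :=
  hB.eventually_nhds_chart hq (Q := fun z => coordField (cotangentModel E) p S.hamField z
    = flatHamField X z) fun q hq => by
    rw [coordField_apply _ (hB.subset_source hq), hB.dchart_hamField q hq]

theorem isFlatFrame (hB : IsAdaptedChart S hor p X Γ B) {c : ℝ → CotangentBundle E M} {ε : ℝ}
    (fr : S.CanonicalFrame c ε) {J : Set ℝ} (hJε : J ⊆ Set.Ioo (-ε) ε)
    (hJB : ∀ t ∈ J, c t ∈ B) :
    IsFlatFrame (flatHamField X) (fun t => extChartAt (cotangentModel E) p (c t)) fr.Y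
      (fun b t => dchart (cotangentModel E) p (c t) (fr.e b t))
      (fun b t => dchart (cotangentModel E) p (c t) (fr.f b t)) fr.R J := by
  have hnhds : ∀ t ∈ J, Set.Ioo (-ε) ε ∈ 𝓝 t := fun t ht => isOpen_Ioo.mem_nhds (hJε ht)
  have hsrc : ∀ t ∈ J, c t ∈ (extChartAt (cotangentModel E) p).source := fun t ht =>
    hB.subset_source (hJB t ht)
  have lie : ∀ t ∈ J, ∀ {V : ∀ t, TangentSpace (cotangentModel E) (c t)}
      {W : TangentSpace (cotangentModel E) (c t)},
      HasLieDerivAlong (cotangentModel E) S.hamField c V t W →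
      SmoothFieldAlongOn (cotangentModel E) c V (Set.Ioo (-ε) ε) →
      HasDerivAt (fun t => dchart (cotangentModel E) p (c t) (V t))
        (dchart (cotangentModel E) p (c t) W + fderiv ℝ (flatHamField X)
          (extChartAt (cotangentModel E) p (c t)) (dchart (cotangentModel E) p (c t) (V t))) t := by
    intro t ht V W hW hV
    have hev := hB.coordField_hamField (hJB t ht)
    rw [← hev.fderiv_eq]
    refine dchart_lieDeriv (cotangentModel E) hW fr.extremal.2 (hnhds t ht) (hsrc t ht) ?_ hV
    exact hev.differentiableAt_iff.2
      ((contDiffAt_flatHamField (hB.smooth_X _ (hJB t ht))).differentiableAt (by simp))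
  exact
    { integral := fun t ht => by
        rw [← hB.dchart_hamField _ (hJB t ht)]
        exact hasDerivAt_coordCurve _ fr.extremal.2 (hnhds t ht) (hsrc t ht)
      vertical_e := fun t ht b =>
        (mem_vertical_iff (hsrc t ht) _).1 (fr.vertical_e t (hJε ht) b)
      darboux_ee := fun t ht b b' => by
        rw [← symplectic_eq (hsrc t ht)]; exact fr.darboux_ee t (hJε ht) b b'
      darboux_ff := fun t ht b b' => by
        rw [← symplectic_eq (hsrc t ht)]; exact fr.darboux_ff t (hJε ht) b b'
      darboux_ef := fun t ht b b' => by
        rw [← symplectic_eq (hsrc t ht)]; exact fr.darboux_ef t (hJε ht) b b'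
      deriv_e_succ := fun t ht a i h h' =>
        lie t ht (fr.deriv_e_succ t (hJε ht) a i h h') (fr.smooth_e _)
      deriv_e_zero := fun t ht a h => by
        have := lie t ht (fr.deriv_e_zero t (hJε ht) a h) (fr.smooth_e _)
        rwa [map_neg] at this
      deriv_f := fun t ht a i h h' => by
        have := lie t ht (fr.deriv_f t (hJε ht) a i h h') (fr.smooth_f _)
        simpa only [map_sub, map_sum, map_smul] using this
      deriv_f_last := fun t ht a i h h' => by
        have := lie t ht (fr.deriv_f_last t (hJε ht) a i h h') (fr.smooth_f _)
        simpa only [map_sum, map_smul] using this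
      normal := fun t ht => fr.normal t (hJε ht) }

variable [FiniteDimensional ℝ E] {U : Set (CotangentBundle E M)}

/-- Along a canonical frame, `Γ` is symmetric, its graph contains the Hamiltonian field, and it is
spanned by the frame. -/
theorem exists_times (hB : IsAdaptedChart S hor p X Γ B) (hor_conn : IsEhresmannConnectionOn hor U)
    (hor_can : ∀ p ∈ U ∩ interior S.ampleEquiregularCovectors, hor p = S.canonicalHor p)
    (hBU : B ⊆ U) {c : ℝ → CotangentBundle E M} {ε : ℝ} (fr : S.CanonicalFrame c ε)
    (hc : c 0 ∈ B ∩ interior S.ampleEquiregularCovectors) :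
    ∃ J : Set ℝ, IsOpen J ∧ (0 : ℝ) ∈ J ∧ J ⊆ Set.Ioo (-ε) ε ∧ ∀ t ∈ J, c t ∈ B ∧
      Submodule.span ℝ (Set.range fun b => fr.f b t) = hor (c t) := by
  have hcont : ContinuousOn c (Set.Ioo (-ε) ε) := fun t ht =>
    (continuousAt_of_isMIntegralCurveOn _ fr.extremal.2 (isOpen_Ioo.mem_nhds ht)).continuousWithinAt
  -- The times at which the extremal stays in `B` and in the interior of the ample equiregular
  -- covectors. They form an open set, so identities along the frame can be differentiated there.
  refine ⟨_, hcont.isOpen_inter_preimage isOpen_Ioo (hB.isOpen.inter isOpen_interior),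
    ⟨⟨neg_lt_zero.2 fr.extremal.1, fr.extremal.1⟩, hc⟩, Set.inter_subset_left, ?_⟩
  rintro t ⟨ht, htB, htN⟩
  have hcan := hor_can _ ⟨hBU htB, htN⟩
  exact ⟨htB, hcan ▸ fr.span_f_eq_of_mem ht (hcan ▸ hor_conn.isCompl _ (hBU htB))⟩

omit [FiniteDimensional ℝ E] in
theorem mem_span_dchart (hB : IsAdaptedChart S hor p X Γ B) {c : ℝ → CotangentBundle E M} {ε : ℝ}
    (fr : S.CanonicalFrame c ε) {t : ℝ} (ht : c t ∈ B)
    (hspan : Submodule.span ℝ (Set.range fun b => fr.f b t) = hor (c t)) (u : E) :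
    ((u, Γ (extChartAt (cotangentModel E) p (c t)) u) : E × (E →L[ℝ] ℝ)) ∈
      Submodule.span ℝ (Set.range fun b => dchart (cotangentModel E) p (c t) (fr.f b t)) := by
  obtain ⟨v, hv⟩ := (dchart_bijective (cotangentModel E) (hB.subset_source ht)).2
    (u, Γ (extChartAt (cotangentModel E) p (c t)) u)
  have hmem : v ∈ hor (c t) := (hB.mem_hor_iff _ ht v).2 (by rw [hv])
  rw [← hspan] at hmem
  obtain ⟨a, rfl⟩ := (Submodule.mem_span_range_iff_exists_fun ℝ).1 hmem
  refine (Submodule.mem_span_range_iff_exists_fun ℝ).2 ⟨a, ?_⟩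
  rw [← hv, map_sum]
  exact Finset.sum_congr rfl fun b _ => (map_smul _ _ _).symm

theorem lagrangian (hB : IsAdaptedChart S hor p X Γ B) (hor_conn : IsEhresmannConnectionOn hor U)
    (hor_can : ∀ p ∈ U ∩ interior S.ampleEquiregularCovectors, hor p = S.canonicalHor p)
    (hBU : B ⊆ U) {q : CotangentBundle E M}
    (hq : q ∈ B ∩ interior S.ampleEquiregularCovectors) :
    (∀ u v, Γ (extChartAt (cotangentModel E) p q) u v = Γ (extChartAt (cotangentModel E) p q) v u) ∧
    (flatHamField X (extChartAt (cotangentModel E) p q)).2 =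
      Γ (extChartAt (cotangentModel E) p q)
        (flatHamField X (extChartAt (cotangentModel E) p q)).1 := by
  obtain ⟨c, ε, fr, rfl⟩ := S.exists_canonicalFrame (interior_subset hq.2)
    (hor_can q ⟨hBU hq.1, hq.2⟩ ▸ hor_conn.isCompl q (hBU hq.1))
  obtain ⟨J, hJ, h0, hJε, hJB⟩ := hB.exists_times hor_conn hor_can hBU fr hq
  exact (hB.isFlatFrame fr hJε fun t ht => (hJB t ht).1).lagrangian_of_mem_span hJ
    (fun t ht => hB.smooth_X _ (hJB t ht).1) h0 (hB.mem_span_dchart fr hq.1 (hJB 0 h0).2)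

omit [FiniteDimensional ℝ E] in
theorem stdSymplectic_graph_eq_zero {L : E →L[ℝ] E →L[ℝ] ℝ} (hL : ∀ u v, L u v = L v u)
    {v w : E × (E →L[ℝ] ℝ)} (hv : v.2 = L v.1) (hw : w.2 = L w.1) : stdSymplectic v w = 0 := by
  rw [stdSymplectic, hv, hw, hL, sub_self]

/-- The right-hand side involves no frame. Any value admissible in the choice defining the curvature
equals it, so the choice is harmless. -/
theorem canonicalCurvature_eq (hB : IsAdaptedChart S hor p X Γ B)
    (hor_conn : IsEhresmannConnectionOn hor U)
    (hor_can : ∀ p ∈ U ∩ interior S.ampleEquiregularCovectors, hor p = S.canonicalHor p)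
    (hBU : B ⊆ U) {q : CotangentBundle E M}
    (hq : q ∈ B ∩ interior S.ampleEquiregularCovectors) (Y Y' : ∀ x : M, TangentSpace 𝓘(ℝ, E) x)
    (hY : ContDiffAt ℝ ∞ (coordField 𝓘(ℝ, E) p.proj Y)
      (extChartAt (cotangentModel E) p q).1) :
    S.canonicalCurvature q (Y q.proj) (Y' q.proj) =
      stdSymplectic (fderiv ℝ (flatLift Γ (coordField 𝓘(ℝ, E) p.proj Y))
          (extChartAt (cotangentModel E) p q)
          (flatHamField X (extChartAt (cotangentModel E) p q))
        - fderiv ℝ (flatHamField X) (extChartAt (cotangentModel E) p q)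
          (flatLift Γ (coordField 𝓘(ℝ, E) p.proj Y) (extChartAt (cotangentModel E) p q)))
        (flatLift Γ (coordField 𝓘(ℝ, E) p.proj Y') (extChartAt (cotangentModel E) p q)) := by
  have hcompl := hor_conn.isCompl q (hBU hq.1)
  -- A canonical frame exists and its projections span the tangent space, so the choice is made
  -- among actual values.
  have hex : ∃ r, S.IsCanonicalCurvature q (Y q.proj) (Y' q.proj) r := by
    obtain ⟨c, ε, fr, rfl⟩ := S.exists_canonicalFrame (interior_subset hq.2)
      (hor_can q ⟨hBU hq.1, hq.2⟩ ▸ hcompl)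
    obtain ⟨J, hJ, h0, hJε, hJB⟩ := hB.exists_times hor_conn hor_can hBU fr hq
    have key : ∀ u : TangentSpace 𝓘(ℝ, E) (c 0).proj, ∃ α : fr.Y.cells → ℝ,
        ∑ b, α b • dproj (c 0) (fr.f b 0) = u := by
      intro u
      obtain ⟨v, hv, rfl⟩ := exists_mem_dproj_eq hcompl u
      rw [← (hJB 0 h0).2] at hv
      obtain ⟨α, rfl⟩ := (Submodule.mem_span_range_iff_exists_fun ℝ).1 hv
      exact ⟨α, by rw [map_sum]; exact Finset.sum_congr rfl fun b _ => (map_smul _ _ _).symm⟩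
    obtain ⟨α, hα⟩ := key (Y (c 0).proj)
    obtain ⟨β, hβ⟩ := key (Y' (c 0).proj)
    exact ⟨_, c, ε, fr, α, β, rfl, by rw [hα], by rw [hβ], rfl⟩
  obtain ⟨c, ε, fr, α, β, rfl, hα, hβ, hr⟩ := Classical.epsilon_spec hex
  have hα' : ∑ b, α b • dproj (c 0) (fr.f b 0) = Y (c 0).proj := by simpa using hα
  have hβ' : ∑ b, β b • dproj (c 0) (fr.f b 0) = Y' (c 0).proj := by simpa using hβ
  obtain ⟨J, hJ, h0, hJε, hJB⟩ := hB.exists_times hor_conn hor_can hBU fr hq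
  have hfr := hB.isFlatFrame fr hJε fun t ht => (hJB t ht).1
  have hJX : ∀ t ∈ J, ∀ i, ContDiffAt ℝ ∞ (X i) (extChartAt (cotangentModel E) p (c t)).1 :=
    fun t ht => hB.smooth_X _ (hJB t ht).1
  have hf : ∀ t ∈ J, ∀ b, (dchart (cotangentModel E) p (c t) (fr.f b t)).2 =
      Γ (extChartAt (cotangentModel E) p (c t))
        (dchart (cotangentModel E) p (c t) (fr.f b t)).1 := fun t ht b =>
    (hB.mem_hor_iff _ (hJB t ht).1 _).1 ((hJB t ht).2 ▸ Submodule.subset_span ⟨b, rfl⟩)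
  have hlift : ∀ (α : fr.Y.cells → ℝ) (Y : ∀ x : M, TangentSpace 𝓘(ℝ, E) x),
      ∑ b, α b • dproj (c 0) (fr.f b 0) = Y (c 0).proj →
      ∑ b, α b • dchart (cotangentModel E) p (c 0) (fr.f b 0) =
        flatLift Γ (coordField 𝓘(ℝ, E) p.proj Y) (extChartAt (cotangentModel E) p (c 0)) := by
    intro α Y h
    have hs := hB.subset_source hq.1
    have h1 : (∑ b, α b • dchart (cotangentModel E) p (c 0) (fr.f b 0)).1 =
        coordField 𝓘(ℝ, E) p.proj Y (extChartAt (cotangentModel E) p (c 0)).1 := by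
      rw [cotangentChart_fst, coordField_apply _ (mem_cotangentChart_source.1 hs), ← h, map_sum,
        Prod.fst_sum]
      refine Finset.sum_congr rfl fun b _ => ?_
      rw [Prod.smul_fst, dchart_fst hs, map_smul]
    refine Prod.ext h1 ?_
    simp only [flatLift, ← h1]
    rw [Prod.snd_sum, Prod.fst_sum, map_sum]
    refine Finset.sum_congr rfl fun b _ => ?_
    rw [Prod.smul_snd, Prod.smul_fst, map_smul, hf 0 h0 b]
  have hsum := hfr.sum_R_eq hJ hJX h0
    (V := flatLift Γ (coordField 𝓘(ℝ, E) p.proj Y)) (α := α) (β := β)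
    ((contDiffAt_flatLift (hB.smooth_Γ _ hq.1) hY).differentiableAt (by simp))
    (fun s hs b => stdSymplectic_graph_eq_zero
      (hfr.lagrangian_of_mem_span hJ hJX hs
        (hB.mem_span_dchart fr (hJB s hs).1 (hJB s hs).2)).1 rfl (hf s hs b))
    (hlift α Y hα')
  rw [hlift β Y' hβ'] at hsum
  rw [← hsum]
  exact hr

end IsAdaptedChart

end Adapted

/-! ### Comparison with the Ehresmann curvature, and the limit -/

section Curvature

variable {E M : Type*} [NormedAddCommGroup E] [NormedSpace ℝ E] [FiniteDimensional ℝ E]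
  [TopologicalSpace M] [ChartedSpace E M] [IsManifold 𝓘(ℝ, E) ∞ M]
  {S : SubRiemannianStructure E M}
  {hor : ∀ p : CotangentBundle E M, Submodule ℝ (TangentSpace (cotangentModel E) p)}
  {U : Set (CotangentBundle E M)} {p : CotangentBundle E M} {X : Fin S.rank → E → E}
  {Γ : E × (E →L[ℝ] ℝ) → E →L[ℝ] E →L[ℝ] ℝ} {B : Set (CotangentBundle E M)}

omit [FiniteDimensional ℝ E] in
/-- The tangent field of a section of the cotangent bundle in coordinates. -/
theorem IsAdaptedChart.tangentField_coord {x : M} {lam : ∀ x : M, TangentSpace 𝓘(ℝ, E) x →L[ℝ] ℝ}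
    (hB : IsAdaptedChart S hor ⟨x, lam x⟩ X Γ B)
    (hlam : ContMDiffAt 𝓘(ℝ, E) (cotangentModel E) ∞
      (fun x => (⟨x, lam x⟩ : CotangentBundle E M)) x) :
    DifferentiableAt ℝ (coordField 𝓘(ℝ, E) x (S.tangentField lam)) (extChartAt 𝓘(ℝ, E) x x) ∧
    coordField 𝓘(ℝ, E) x (S.tangentField lam) (extChartAt 𝓘(ℝ, E) x x) =
      (flatHamField X (extChartAt (cotangentModel E) (⟨x, lam x⟩ : CotangentBundle E M)
        ⟨x, lam x⟩)).1 := by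
  set p : CotangentBundle E M := ⟨x, lam x⟩ with hp
  set s : M → CotangentBundle E M := fun x => ⟨x, lam x⟩ with hs
  have hev : coordField 𝓘(ℝ, E) x (S.tangentField lam) =ᶠ[𝓝 (extChartAt 𝓘(ℝ, E) x x)]
      fun y => (flatHamField X (extChartAt (cotangentModel E) p
        (s ((extChartAt 𝓘(ℝ, E) x).symm y)))).1 := by
    have h2 : ∀ᶠ y in 𝓝 (extChartAt 𝓘(ℝ, E) x x), s ((extChartAt 𝓘(ℝ, E) x).symm y) ∈ B := by
      have hcont : ContinuousAt (fun y => s ((extChartAt 𝓘(ℝ, E) x).symm y))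
          (extChartAt 𝓘(ℝ, E) x x) := by
        refine ContinuousAt.comp (g := s) ?_ (continuousAt_extChartAt_symm x)
        rw [extChartAt_to_inv]
        exact hlam.continuousAt
      refine hcont.preimage_mem_nhds ?_
      rw [extChartAt_to_inv]
      exact hB.isOpen.mem_nhds hB.mem
    filter_upwards [h2] with y hy
    rw [← hB.dchart_hamField _ hy, dchart_fst (hB.subset_source hy)]
    rfl
  have hsmooth : ContDiffAt ℝ ∞ (fun y => extChartAt (cotangentModel E) p
      (s ((extChartAt 𝓘(ℝ, E) x).symm y))) (extChartAt 𝓘(ℝ, E) x x) := by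
    have h4 : ContMDiffAt 𝓘(ℝ, E) 𝓘(ℝ, E) ∞ (extChartAt 𝓘(ℝ, E) x).symm (extChartAt 𝓘(ℝ, E) x x) :=
      (contMDiffOn_extChartAt_symm x).contMDiffAt (extChartAt_target_mem_nhds x)
    have h5 : ContMDiffAt 𝓘(ℝ, E) 𝓘(ℝ, E × (E →L[ℝ] ℝ)) ∞
        (fun x => extChartAt (cotangentModel E) p (s x)) x :=
      ContMDiffAt.comp x (g := extChartAt (cotangentModel E) p) (f := s)
        contMDiffAt_extChartAt hlam
    have h6 := ContMDiffAt.comp (extChartAt 𝓘(ℝ, E) x x)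
      (g := fun x => extChartAt (cotangentModel E) p (s x)) (f := (extChartAt 𝓘(ℝ, E) x).symm)
      (by rw [extChartAt_to_inv]; exact h5) h4
    exact h6.contDiffAt
  constructor
  · rw [hev.differentiableAt_iff]
    have h7 := (contDiffAt_flatHamField (hB.smooth_X p hB.mem)).fst
    have h8 := ContDiffAt.comp (extChartAt 𝓘(ℝ, E) x x)
      (g := fun z => (flatHamField X z).1) (f := fun y => extChartAt (cotangentModel E) p
      (s ((extChartAt 𝓘(ℝ, E) x).symm y))) (by rw [extChartAt_to_inv]; exact h7) hsmooth
    exact h8.differentiableAt (by simp)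
  · rw [hev.eq_of_nhds, extChartAt_to_inv]

omit [FiniteDimensional ℝ E] in
/-- The Ehresmann curvature in coordinates. -/
theorem IsAdaptedChart.symplectic_ehresmannCurvature (hB : IsAdaptedChart S hor p X Γ B)
    (hsymm : ∀ u v, Γ (extChartAt (cotangentModel E) p p) u v =
      Γ (extChartAt (cotangentModel E) p p) v u) (T Y Y' : ∀ x : M, TangentSpace 𝓘(ℝ, E) x) :
    symplectic p (ehresmannCurvature hor T Y p) (horizontalLift hor Y' p) =
      stdSymplectic (fderiv ℝ (flatLift Γ (coordField 𝓘(ℝ, E) p.proj Y))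
          (extChartAt (cotangentModel E) p p)
          (flatLift Γ (coordField 𝓘(ℝ, E) p.proj T) (extChartAt (cotangentModel E) p p))
        - fderiv ℝ (flatLift Γ (coordField 𝓘(ℝ, E) p.proj T)) (extChartAt (cotangentModel E) p p)
          (flatLift Γ (coordField 𝓘(ℝ, E) p.proj Y) (extChartAt (cotangentModel E) p p)))
        (flatLift Γ (coordField 𝓘(ℝ, E) p.proj Y') (extChartAt (cotangentModel E) p p)) := by
  have hT := hB.coordField_horizontalLift hB.mem T
  have hY := hB.coordField_horizontalLift hB.mem Y
  -- The horizontal term `∇_{[T, Y]}` pairs to zero with `∇_{Y'}`.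
  have h0 := IsAdaptedChart.stdSymplectic_graph_eq_zero hsymm
    (v := flatLift Γ (coordField 𝓘(ℝ, E) p.proj (VectorField.mlieBracket 𝓘(ℝ, E) T Y))
      (extChartAt (cotangentModel E) p p))
    (w := flatLift Γ (coordField 𝓘(ℝ, E) p.proj Y') (extChartAt (cotangentModel E) p p)) rfl rfl
  rw [symplectic_eq (hB.subset_source hB.mem), ehresmannCurvature, map_sub, dchart_mlieBracket,
    stdSymplectic_sub_left, hB.dchart_horizontalLift hB.mem, hB.dchart_horizontalLift hB.mem,
    hT.fderiv_eq, hY.fderiv_eq, hT.eq_of_nhds, hY.eq_of_nhds,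
    h0, sub_zero]

/-- The canonical curvature converges to the curvature of the Ehresmann connection. -/
theorem tendsto_canonicalCurvature (hU : IsOpen U) (hor_conn : IsEhresmannConnectionOn hor U)
    (hor_can : ∀ p ∈ U ∩ interior S.ampleEquiregularCovectors, hor p = S.canonicalHor p)
    {W : Set M} (hW : IsOpen W) {lam : ∀ x : M, TangentSpace 𝓘(ℝ, E) x →L[ℝ] ℝ}
    (hlam : ContMDiffOn 𝓘(ℝ, E) (cotangentModel E) ∞
      (fun x => (⟨x, lam x⟩ : CotangentBundle E M)) W)
    (hlamU : ∀ x ∈ W, (⟨x, lam x⟩ : CotangentBundle E M) ∈ U)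
    {Y Y' : ∀ x : M, TangentSpace 𝓘(ℝ, E) x} (hY : SmoothFieldOn 𝓘(ℝ, E) Y W)
    (hY' : SmoothFieldOn 𝓘(ℝ, E) Y' W) {x : M} (hx : x ∈ W) :
    Filter.Tendsto
      (fun q : CotangentBundle E M => S.canonicalCurvature q (Y q.proj) (Y' q.proj))
      (𝓝[interior S.ampleEquiregularCovectors] ⟨x, lam x⟩)
      (𝓝 (symplectic ⟨x, lam x⟩ (ehresmannCurvature hor (S.tangentField lam) Y ⟨x, lam x⟩)
        (horizontalLift hor Y' ⟨x, lam x⟩))) := by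
  obtain ⟨X, Γ, B, hB, hBU⟩ := exists_isAdaptedChart S hor_conn hU (hlamU x hx)
  obtain ⟨hT, hT0⟩ := hB.tangentField_coord (hlam.contMDiffAt (hW.mem_nhds hx))
  set p : CotangentBundle E M := ⟨x, lam x⟩ with hp
  set N := interior S.ampleEquiregularCovectors with hN
  set χ := extChartAt (cotangentModel E) p with hχ
  -- Away from the closure of `N` the limit is vacuous.
  rcases (𝓝[N] p).eq_or_neBot with hbot | hne
  · rw [hbot]; exact Filter.tendsto_bot
  have hχc : ContinuousAt χ p := continuousAt_extChartAt p
  have hproj : Continuous (fun q : CotangentBundle E M => q.proj) :=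
    (Bundle.contMDiff_proj (n := 1) (IB := 𝓘(ℝ, E)) (F := E →L[ℝ] ℝ)
      (fun x : M => TangentSpace 𝓘(ℝ, E) x →L[ℝ] ℝ)).continuous
  -- the image of `N` in the chart
  set N' : Set (E × (E →L[ℝ] ℝ)) := χ.target ∩ χ.symm ⁻¹' (B ∩ N) with hN'
  have hN'open : IsOpen N' := (continuousOn_extChartAt_symm p).isOpen_inter_preimage
    (isOpen_extChartAt_target p) (hB.isOpen.inter isOpen_interior)
  have hN'mem : ∀ z ∈ N', ∃ q ∈ B ∩ N, χ q = z := fun z hz => ⟨_, hz.2, χ.right_inv hz.1⟩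
  have hclosure : χ p ∈ closure N' := by
    refine mem_closure_of_tendsto (hχc.mono_left nhdsWithin_le_nhds : Filter.Tendsto χ (𝓝[N] p) _) ?_
    filter_upwards [self_mem_nhdsWithin, nhdsWithin_le_nhds (hB.isOpen.mem_nhds hB.mem)] with q hqN hqB
    have hq := hB.subset_source hqB
    exact ⟨χ.map_source hq, by rw [Set.mem_preimage, χ.left_inv hq]; exact ⟨hqB, hqN⟩⟩
  have hlag : ∀ z ∈ N', (∀ u v, Γ z u v = Γ z v u) ∧
      (flatHamField X z).2 = Γ z (flatHamField X z).1 := by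
    intro z hz
    obtain ⟨q, hq, rfl⟩ := hN'mem z hz
    exact hB.lagrangian hor_conn hor_can hBU hq
  have hΓ : ContDiffAt ℝ ∞ Γ (χ p) := hB.smooth_Γ p hB.mem
  have hZ : ContDiffAt ℝ ∞ (flatHamField X) (χ p) := contDiffAt_flatHamField (hB.smooth_X p hB.mem)
  have hfst : ∀ q, (χ q).1 = extChartAt 𝓘(ℝ, E) x q.proj := fun q => cotangentChart_fst p q
  have hcoord : ∀ {Y : ∀ x : M, TangentSpace 𝓘(ℝ, E) x}, SmoothFieldOn 𝓘(ℝ, E) Y W →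
      ∀ q ∈ B, q.proj ∈ W → ContDiffAt ℝ ∞ (coordField 𝓘(ℝ, E) x Y) (χ q).1 := by
    intro Y hY q hq hqW
    rw [hfst]
    exact contDiffAt_coordField 𝓘(ℝ, E) (mem_cotangentChart_source.1 (hB.subset_source hq)) hY
      (hW.mem_nhds hqW)
  -- `G` is `σ([H⃗, ∇_Y], ∇_{Y'})` in coordinates. It does not involve the section `lam`, so it can
  -- be compared with the curvature at all nearby points of `N`.
  set G : E × (E →L[ℝ] ℝ) → ℝ := fun z =>
    stdSymplectic (fderiv ℝ (flatLift Γ (coordField 𝓘(ℝ, E) x Y)) z (flatHamField X z)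
      - fderiv ℝ (flatHamField X) z (flatLift Γ (coordField 𝓘(ℝ, E) x Y) z))
      (flatLift Γ (coordField 𝓘(ℝ, E) x Y') z) with hG
  have hGc : ContinuousAt G (χ p) := by
    have h1 := contDiffAt_flatLift hΓ (hcoord hY p hB.mem hx)
    have h2 := contDiffAt_flatLift hΓ (hcoord hY' p hB.mem hx)
    have h3 : ContinuousAt (fderiv ℝ (flatLift Γ (coordField 𝓘(ℝ, E) x Y))) (χ p) :=
      (h1.fderiv_right (m := 0) (by norm_cast)).continuousAt
    have h4 : ContinuousAt (fderiv ℝ (flatHamField X)) (χ p) :=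
      (hZ.fderiv_right (m := 0) (by norm_cast)).continuousAt
    have h5 := (h3.clm_apply hZ.continuousAt).sub (h4.clm_apply h1.continuousAt)
    exact (h5.snd.clm_apply h2.continuousAt.fst).sub (h2.continuousAt.snd.clm_apply h5.fst)
  have hsymm := symm_of_mem_closure hΓ.continuousAt hclosure fun z hz => (hlag z hz).1
  have hval : symplectic p (ehresmannCurvature hor (S.tangentField lam) Y p)
      (horizontalLift hor Y' p) = G (χ p) := by
    rw [hB.symplectic_ehresmannCurvature hsymm]
    exact stdSymplectic_bracket_eq (hZ.of_le (by norm_cast)) (hΓ.of_le (by norm_cast)) hN'open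
      hclosure (fun z hz => (hlag z hz).1) (fun z hz => (hlag z hz).2)
      (T := coordField 𝓘(ℝ, E) x (S.tangentField lam)) (by rw [hfst]; exact hT)
      (by rw [hfst]; exact hT0) _ _
  rw [hval]
  have hlim : Filter.Tendsto (fun q => G (χ q)) (𝓝[N] p) (𝓝 (G (χ p))) :=
    (ContinuousAt.comp hGc hχc).mono_left nhdsWithin_le_nhds
  refine hlim.congr' ?_
  filter_upwards [self_mem_nhdsWithin, nhdsWithin_le_nhds (hB.isOpen.mem_nhds hB.mem),
    nhdsWithin_le_nhds ((hW.preimage hproj).mem_nhds hx)] with q hqN hqB hqW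
  exact (hB.canonicalCurvature_eq hor_conn hor_can hBU ⟨hqB, hqN⟩ Y Y' (hcoord hY q hqB hqW)).symm

end Curvature

end SubRiem

end

theorem theoremt {E : Type*} [NormedAddCommGroup E] [NormedSpace ℝ E] [FiniteDimensional ℝ E]
    {M : Type*} [TopologicalSpace M] [T2Space M] [SecondCountableTopology M] [ChartedSpace E M]
    [IsManifold 𝓘(ℝ, E) ∞ M]
    (S : SubRiem.SubRiemannianStructure E M)
    (U : Set (SubRiem.CotangentBundle E M)) (hU : IsOpen U)
    (hor : ∀ p : SubRiem.CotangentBundle E M,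
      Submodule ℝ (TangentSpace (SubRiem.cotangentModel E) p))
    (hor_conn : SubRiem.IsEhresmannConnectionOn hor U)
    (hor_can : ∀ p ∈ U ∩ interior S.ampleEquiregularCovectors, hor p = S.canonicalHor p)
    (W : Set M) (hW : IsOpen W)
    (lam : ∀ x : M, TangentSpace 𝓘(ℝ, E) x →L[ℝ] ℝ)
    (hlam : ContMDiffOn 𝓘(ℝ, E) (SubRiem.cotangentModel E) ∞
      (fun x => (⟨x, lam x⟩ : SubRiem.CotangentBundle E M)) W)
    (hlamU : ∀ x ∈ W, (⟨x, lam x⟩ : SubRiem.CotangentBundle E M) ∈ U)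
    (X Y : ∀ x : M, TangentSpace 𝓘(ℝ, E) x)
    (hX : SubRiem.SmoothFieldOn 𝓘(ℝ, E) X W) (hY : SubRiem.SmoothFieldOn 𝓘(ℝ, E) Y W) :
    (∀ x ∈ W, (⟨x, lam x⟩ : SubRiem.CotangentBundle E M) ∈ interior S.ampleEquiregularCovectors →
      S.canonicalCurvature ⟨x, lam x⟩ (X x) (Y x) =
        SubRiem.symplectic ⟨x, lam x⟩
          (SubRiem.ehresmannCurvature hor (S.tangentField lam) X ⟨x, lam x⟩)
          (SubRiem.horizontalLift hor Y ⟨x, lam x⟩)) ∧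
    (∀ x ∈ W,
      Filter.Tendsto
        (fun q : SubRiem.CotangentBundle E M =>
          S.canonicalCurvature q (X q.proj) (Y q.proj))
        (𝓝[interior S.ampleEquiregularCovectors] ⟨x, lam x⟩)
        (𝓝 (SubRiem.symplectic ⟨x, lam x⟩
          (SubRiem.ehresmannCurvature hor (S.tangentField lam) X ⟨x, lam x⟩)
          (SubRiem.horizontalLift hor Y ⟨x, lam x⟩)))) := by
  have hlim : ∀ x ∈ W, _ := fun x hx =>
    SubRiem.tendsto_canonicalCurvature hU hor_conn hor_can hW hlam hlamU hX hY hx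
  -- When `λ(x)` is in `N`, the limit may be restricted to the point itself, where the function
  -- tends to its own value; uniqueness of limits gives the formula.
  exact ⟨fun x hx hN => tendsto_nhds_unique (tendsto_pure_nhds _ _)
    ((hlim x hx).mono_left (pure_le_nhdsWithin hN)), hlim⟩
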